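/- Let $d>2$, $G=U(1)=\mathbb{R}/\mathbb{Z}$ with Lie algebra $\mathfrak g=\mathbb{R}$ (standard inner product, $\exp(t)=e^{2\pi i t}$), and let $\beta>0$. For a subcomplex $K$ of the cubical cell decomposition of $\mathbb{R}^d$ with vertex set $\mathbb{Z}^d$ let $C^k(K;A)$ be the group of $A$-valued cellular $k$-cochains and $d_{K,k}:C^k(K;A)\to C^{k+1}(K;A)$ the cellular coboundary. Let $\mathcal F$ be the set of finite subcomplexes whose underlying space is a contractible topological $d$-manifold with boundary. Let $I^G$ be the compact Abelian group of all $c\in C^2(\mathbb{Z}^d;G)$ with $c|_K\in \mathrm{Im}\, d_{K,1}^{G}$ for all $K\in\mathcal F$ (the projective limit of the groups $\mathrm{Im}\, d_{K,1}^{G}$), and let $I^{\mathfrak g}$ be the Hilbert space of all $x\in\ell^2$ 2-cochains with values in $\mathbb{R}$ such that $x|_K\in\mathrm{Im}\, d_{K,1}^{\mathfrak g}$ for all $K\in\mathcal F$. For a continuous character $\chi$ of $I^G$ let $J\chi\in (I^{\mathfrak g})^*$ be the continuous linear functional with $\chi(\exp x)=e^{2\pi i\,(J\chi)(x)}$ for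 all $x \in I^{\mathfrak g}$. Then there is a unique Borel probability measure $\mu^H_\beta$ on $I^G$ with $$\int \overline{\chi}\,d\mu^H_\beta=\exp\!\big(-4\pi^2\beta\,\|J\chi\|^2\big)\qquad\text{for all continuous characters }\chi .$$ Let $\mu_{\beta,\mathbb{Z}^d}$ be the pushforward of $\mu^H_\beta$ to the space of gauge classes $C^1(\mathbb{Z}^d;G)/C^0(\mathbb{Z}^d;G)=C^1(\mathbb{Z}^d;G)/\mathrm{Im}\,d_0$ under the inverse of the map $\bar d_1: C^1(\mathbb{Z}^d;G)/C^0(\mathbb{Z}^d;G)\to I^G$ induced by the coboundary. For a plaquette (2-cell) $p$ let $W_p$ be the Wilson loop around $\partial p$, regarded as a complex-valued function of the gauge class, and let $$O_\beta(p,q)=\int W_pW_q\,d\mu_{\beta,\mathbb{Z}^d}-\int W_p\,d\mu_{\beta,\mathbb{Z}^d}\int W_q\,d\mu_{\beta,\mathbb{Z}^d}.$$ Then $\mu_{\beta,\mathbb{Z}^d}$ is invariant under all lattice translations, and for every plaquette $p$ and every lattice direction $e\in\{\pm e_1,\dots,\pm e_d\}$: 1. $|O_\beta(p,p+ne)|\to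 0$ as $n\to\infty$; 2. the decay is not faster than $n^{-d}$: there is $C>0$ (which may depend on $d,\beta,p,e$) such that $|O_\beta(p,p+ne)|\ge C\,n^{-d}$ for all sufficiently large $n$; 3. consequently the theory is massless (there is no exponential decay): for no $m>0$ is $O_\beta(p,p+ne)=O(e^{-mn})$ as $n\to\infty$. -/

import Mathlib

open Filter Topology MeasureTheory

noncomputable section

namespace LatticeGauge

/-! ### The cubical decomposition of `ℝ^d` with vertex set `ℤ^d` -/

/-- A cell of the cubical lattice: the cube with lowest vertex `base` spanned by the standard basis
vectors `e_i`, `i ∈ dirs`. Its dimension is the cardinality of `dirs`, and it is oriented by the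
increasing order of the indices in `dirs`. -/
@[ext]
structure Cell (d : ℕ) where
  base : Fin d → ℤ
  dirs : Finset (Fin d)

variable {d : ℕ}

/-- The facet of `σ` on which the `i`-th coordinate is minimal. -/
def Cell.back (σ : Cell d) (i : Fin d) : Cell d := ⟨σ.base, σ.dirs.erase i⟩

/-- The facet of `σ` on which the `i`-th coordinate is maximal. -/
def Cell.front (σ : Cell d) (i : Fin d) : Cell d := ⟨σ.base + Pi.single i 1, σ.dirs.erase i⟩

/-- The cell `σ + a`, for `a ∈ ℤ^d`. -/
def Cell.shift (a : Fin d → ℤ) (σ : Cell d) : Cell d := ⟨σ.base + a, σ.dirs⟩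

/-- The closed cube in `ℝ^d` described by the cell. -/
def Cell.cube (σ : Cell d) : Set (Fin d → ℝ) :=
  {x | ∀ i, (σ.base i : ℝ) ≤ x i ∧ x i ≤ σ.base i + (if i ∈ σ.dirs then 1 else 0)}

/-- A cell subcomplex of the cubical lattice: a set of cells closed under passing to faces. -/
structure Subcomplex (d : ℕ) where
  cells : Set (Cell d)
  back_mem : ∀ σ ∈ cells, ∀ i ∈ σ.dirs, σ.back i ∈ cells
  front_mem : ∀ σ ∈ cells, ∀ i ∈ σ.dirs, σ.front i ∈ cells

/-- The whole infinite lattice `ℤ^d`. -/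
def lattice (d : ℕ) : Subcomplex d := ⟨Set.univ, fun _ _ _ _ => trivial, fun _ _ _ _ => trivial⟩

/-- The underlying space of a subcomplex, as a subset of `ℝ^d`. -/
def Subcomplex.space (K : Subcomplex d) : Set (Fin d → ℝ) := ⋃ σ ∈ K.cells, σ.cube

/-- The family of all finite subcomplexes whose underlying space is a contractible (in particular
nonempty and connected) topological `d`-manifold with boundary. -/
def finiteSubcomplexes (d : ℕ) [NeZero d] : Set (Subcomplex d) :=
  {K | K.cells.Finite ∧ ContractibleSpace K.space ∧
    Nonempty (ChartedSpace (EuclideanHalfSpace d) K.space)}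

/-! ### Cochains and coboundary operators -/

/-- The `k`-dimensional cells of a subcomplex. -/
abbrev Subcomplex.Face (K : Subcomplex d) (k : ℕ) : Type :=
  {σ : Cell d // σ ∈ K.cells ∧ σ.dirs.card = k}

/-- The group `C^k(K; A)` of `A`-valued `k`-cochains. -/
abbrev Cochain (K : Subcomplex d) (k : ℕ) (A : Type*) : Type _ := K.Face k → A

def Subcomplex.Face.back {K : Subcomplex d} {k : ℕ} (σ : K.Face (k + 1)) (i : Fin d)
    (hi : i ∈ σ.1.dirs) : K.Face k :=
  ⟨σ.1.back i, K.back_mem _ σ.2.1 i hi, by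
    simp [Cell.back, Finset.card_erase_of_mem hi, σ.2.2]⟩

def Subcomplex.Face.front {K : Subcomplex d} {k : ℕ} (σ : K.Face (k + 1)) (i : Fin d)
    (hi : i ∈ σ.1.dirs) : K.Face k :=
  ⟨σ.1.front i, K.front_mem _ σ.2.1 i hi, by
    simp [Cell.front, Finset.card_erase_of_mem hi, σ.2.2]⟩

/-- The cellular coboundary operator `d_k : C^k(K; A) → C^{k+1}(K; A)`, with the standard incidence
numbers: `(d_k c)(σ) = ∑_{i ∈ dirs σ} (-1)^{#{j ∈ dirs σ : j < i}} (c(front_i σ) - c(back_i σ))`. -/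
def coboundary (R : Type*) [CommRing R] (K : Subcomplex d) (k : ℕ) (A : Type*) [AddCommGroup A]
    [Module R A] : Cochain K k A →ₗ[R] Cochain K (k + 1) A where
  toFun c σ := ∑ i ∈ σ.1.dirs.attach,
    ((-1 : ℤ) ^ (σ.1.dirs.filter (· < i.1)).card) • (c (σ.front i.1 i.2) - c (σ.back i.1 i.2))
  map_add' a b := by
    funext σ
    simp only [Pi.add_apply, ← Finset.sum_add_distrib]
    refine Finset.sum_congr rfl fun i _ => ?_
    rw [← smul_add]
    congr 1
    abel
  map_smul' r a := by
    funext σ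
    simp only [Pi.smul_apply, RingHom.id_apply, Finset.smul_sum]
    refine Finset.sum_congr rfl fun i _ => ?_
    rw [← smul_sub, smul_comm]

/-- Restriction of cochains from the infinite lattice to a subcomplex. -/
def restrict (R : Type*) [CommRing R] (K : Subcomplex d) (k : ℕ) (A : Type*) [AddCommGroup A]
    [Module R A] : Cochain (lattice d) k A →ₗ[R] Cochain K k A where
  toFun c σ := c ⟨σ.1, trivial, σ.2.2⟩
  map_add' _ _ := rfl
  map_smul' _ _ := rfl

lemma restrict_coboundary (R : Type*) [CommRing R] (K : Subcomplex d) (k : ℕ) (A : Type*)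
    [AddCommGroup A] [Module R A] (c : Cochain (lattice d) k A) :
    restrict R K (k + 1) A (coboundary R (lattice d) k A c) =
      coboundary R K k A (restrict R K k A c) := rfl

lemma coboundary_map (R S : Type*) [CommRing R] [CommRing S] (K : Subcomplex d) (k : ℕ)
    {A B : Type*} [AddCommGroup A] [AddCommGroup B] [Module R A] [Module S B] (f : A →+ B)
    (c : Cochain K k A) :
    coboundary S K k B (fun σ => f (c σ)) = fun σ => f (coboundary R K k A c σ) := by
  funext σ
  simp [coboundary, map_sum]

lemma coboundary_coboundary (R : Type*) [CommRing R] (A : Type*) [AddCommGroup A] [Module R A]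
    (c : Cochain (lattice d) 0 A) :
    coboundary R (lattice d) 1 A (coboundary R (lattice d) 0 A c) = 0 := by
  let g : (Fin d → ℤ) → A := fun v => c ⟨⟨v, ∅⟩, trivial, rfl⟩
  let D : (Fin d → ℤ) → Finset (Fin d) → A := fun v S =>
    ∑ l ∈ S, ((-1 : ℤ) ^ (S.filter (· < l)).card) • (g (v + Pi.single l 1) - g v)
  have h0 : ∀ τ : (lattice d).Face 0, c τ = g τ.1.base := by
    intro τ
    refine congrArg c (Subtype.ext (Cell.ext rfl ?_))
    exact Finset.card_eq_zero.1 τ.2.2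
  have h1 : ∀ τ : (lattice d).Face 1,
      coboundary R (lattice d) 0 A c τ = D τ.1.base τ.1.dirs := by
    intro τ
    change ∑ i ∈ τ.1.dirs.attach, _ = _
    simp only [D]
    rw [← Finset.sum_attach τ.1.dirs]
    refine Finset.sum_congr rfl fun i _ => ?_
    rw [h0, h0]
    rfl
  have h2 : ∀ σ : (lattice d).Face 2,
      coboundary R (lattice d) 1 A (coboundary R (lattice d) 0 A c) σ =
        ∑ l ∈ σ.1.dirs, ((-1 : ℤ) ^ (σ.1.dirs.filter (· < l)).card) •
          (D (σ.1.base + Pi.single l 1) (σ.1.dirs.erase l) -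
            D σ.1.base (σ.1.dirs.erase l)) := by
    intro σ
    change ∑ i ∈ σ.1.dirs.attach, _ = _
    rw [← Finset.sum_attach σ.1.dirs]
    refine Finset.sum_congr rfl fun i _ => ?_
    rw [h1, h1]
    rfl
  funext σ
  rw [h2]
  obtain ⟨i, j, hij, hS⟩ := Finset.card_eq_two.1 σ.2.2
  rw [hS]
  wlog hlt : i < j generalizing i j
  · rw [Finset.pair_comm]
    exact this j i hij.symm (by rw [hS, Finset.pair_comm])
      (lt_of_le_of_ne (not_lt.1 hlt) hij.symm)
  have e1 : ({i, j} : Finset (Fin d)).erase i = {j} := by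
    ext x; simp only [Finset.mem_erase, Finset.mem_insert, Finset.mem_singleton]; grind
  have e2 : ({i, j} : Finset (Fin d)).erase j = {i} := by
    ext x; simp only [Finset.mem_erase, Finset.mem_insert, Finset.mem_singleton]; grind
  have f1 : ({i, j} : Finset (Fin d)).filter (· < i) = ∅ := by
    ext x; simp only [Finset.mem_filter, Finset.mem_insert, Finset.mem_singleton]; grind
  have f2 : ({i, j} : Finset (Fin d)).filter (· < j) = {i} := by
    ext x; simp only [Finset.mem_filter, Finset.mem_insert, Finset.mem_singleton]; grind
  rw [Finset.sum_pair hij, e1, e2, f1, f2]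
  simp only [D, Finset.sum_singleton, Finset.filter_singleton, lt_irrefl, if_false,
    Finset.card_empty, Finset.card_singleton, pow_zero, pow_one, one_smul, neg_smul,
    Pi.zero_apply]
  rw [add_right_comm σ.1.base (Pi.single i 1) (Pi.single j 1)]
  abel

/-- The projective limit, over the finite subcomplexes `K` in the family, of the groups `Im d_{K,1}`
of exact `A`-valued 2-cochains on `K` and the restriction maps, realised as a group of 2-cochains on
the infinite lattice. -/
def limitExact (d : ℕ) [NeZero d] (R : Type*) [CommRing R] (A : Type*) [AddCommGroup A]
    [Module R A] : Submodule R (Cochain (lattice d) 2 A) :=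
  ⨅ K ∈ finiteSubcomplexes d,
    (LinearMap.range (coboundary R K 1 A)).comap (restrict R K 2 A)

lemma mem_limitExact [NeZero d] {R : Type*} [CommRing R] {A : Type*} [AddCommGroup A]
    [Module R A] {c : Cochain (lattice d) 2 A} :
    c ∈ limitExact d R A ↔ ∀ K ∈ finiteSubcomplexes d,
      ∃ b : Cochain K 1 A, coboundary R K 1 A b = restrict R K 2 A c := by
  simp [limitExact, Submodule.mem_iInf]

/-! ### Gauge group `U(1)`

The group `U(1)` is written additively as `ℝ/ℤ`, with Lie algebra `ℝ` (and its standard inner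
product) and exponential map the projection `ℝ → ℝ/ℤ`, that is `t ↦ e^{2πit}`. -/

/-- The structure group `U(1) = ℝ/ℤ`. -/
abbrev U1 : Type := UnitAddCircle

/-- The compact Abelian group `Im d_{ℤ^d,1}^G`, the limit of the groups `Im d_{K,1}^G`. -/
abbrev ExactG (d : ℕ) [NeZero d] : Type := limitExact d ℤ U1

/-- The Hilbert space `Im d_{ℤ^d,1}^𝔤`: the limit, in the category of Hilbert spaces and linear
contractions, of the spaces `Im d_{K,1}^𝔤` with their Euclidean (`ℓ²`) inner products. It consists of
the square summable 2-cochains whose restriction to every `K` is exact on `K`. -/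
def exactL2 (d : ℕ) [NeZero d] :
    Submodule ℝ (lp (fun _ : (lattice d).Face 2 => ℝ) 2) where
  carrier := {c | (⇑c : Cochain (lattice d) 2 ℝ) ∈ limitExact d ℝ ℝ}
  zero_mem' := by
    simp only [Set.mem_ofPred_eq, lp.coeFn_zero]
    exact Submodule.zero_mem _
  add_mem' {a b} ha hb := by
    simp only [Set.mem_ofPred_eq, lp.coeFn_add] at *
    exact Submodule.add_mem _ ha hb
  smul_mem' r a ha := by
    simp only [Set.mem_ofPred_eq, lp.coeFn_smul] at *
    exact Submodule.smul_mem _ r ha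

/-- The exponential map `Im d_{ℤ^d,1}^𝔤 → Im d_{ℤ^d,1}^G`, cell by cell. -/
def expMap [NeZero d] (x : exactL2 d) : ExactG d :=
  ⟨fun p => ((x.1 p : ℝ) : U1), by
    rw [mem_limitExact]
    intro K hK
    obtain ⟨b, hb⟩ := mem_limitExact.1 x.2 K hK
    refine ⟨fun σ => ((b σ : ℝ) : U1), ?_⟩
    have h := coboundary_map ℝ ℤ K 1 (QuotientAddGroup.mk' (AddSubgroup.zmultiples (1 : ℝ))) b
    rw [hb] at h
    exact h⟩

/-- The continuous characters of a topological group. -/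
abbrev Character (G : Type*) [AddCommGroup G] [TopologicalSpace G] : Type _ :=
  {χ : AddChar G Circle // Continuous χ}

/-- The map `J` from the characters of `Im d_{ℤ^d,1}^G` to the dual of the Hilbert space
`Im d_{ℤ^d,1}^𝔤`: `J χ` is the (unique) continuous linear functional `ξ` with
`χ (exp x) = e^{2πi ξ(x)}`, i.e. the differential of `χ` (divided by `2πi`). -/
def charDifferential [NeZero d] (χ : Character (ExactG d)) : exactL2 d →L[ℝ] ℝ :=
  Classical.epsilon fun ξ => ∀ x, χ.1 (expMap x) = Circle.exp (2 * Real.pi * ξ x)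

/-- `μ` is a heat kernel measure with parameter `β` for a group `G`, a Hilbert space `H` and a map
`J : Ĝ → H^*`: a Borel probability measure on `G` whose Fourier transform is
`χ ↦ exp(-4π²β‖J χ‖²)`. -/
def IsHeatKernelMeasure {G : Type*} [AddCommGroup G] [TopologicalSpace G] [MeasurableSpace G]
    {H : Type*} [NormedAddCommGroup H] [InnerProductSpace ℝ H] (J : Character G → (H →L[ℝ] ℝ))
    (β : ℝ) (μ : Measure G) : Prop :=
  IsProbabilityMeasure μ ∧ ∀ χ : Character G,
    ∫ x, (starRingEnd ℂ) (χ.1 x : ℂ) ∂μ = (Real.exp (-4 * Real.pi ^ 2 * β * ‖J χ‖ ^ 2) : ℝ)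

/-- The heat kernel measure `μ^H_β` on `Im d_{ℤ^d,1}^G`. -/
def heatKernelMeasure (d : ℕ) [NeZero d] (β : ℝ) : Measure (ExactG d) :=
  Classical.epsilon fun μ => IsHeatKernelMeasure charDifferential β μ

/-! ### Gauge classes of `U(1)` lattice gauge fields and the infinite lattice measure -/

/-- The subgroup `Im d_0` of pure gauge 1-cochains. -/
def pureGauge (d : ℕ) : AddSubgroup (Cochain (lattice d) 1 U1) :=
  (LinearMap.range (coboundary ℤ (lattice d) 0 U1)).toAddSubgroup

/-- The space `C^1(ℤ^d; G) / C^0(ℤ^d; G)` of gauge equivalence classes. -/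
abbrev GaugeClass (d : ℕ) : Type := Cochain (lattice d) 1 U1 ⧸ pureGauge d

/-- The coboundary of a 1-cochain on the lattice, as an element of `Im d_{ℤ^d,1}^G`. -/
def curvature (d : ℕ) [NeZero d] : Cochain (lattice d) 1 U1 →+ ExactG d where
  toFun c := ⟨coboundary ℤ (lattice d) 1 U1 c, mem_limitExact.2 fun K _ =>
    ⟨restrict ℤ K 1 U1 c, (restrict_coboundary ℤ K 1 U1 c).symm⟩⟩
  map_zero' := Subtype.ext (map_zero _)
  map_add' a b := Subtype.ext (map_add _ a b)

/-- The map `C^1/C^0 → Im d_{ℤ^d,1}^G` induced by the coboundary operator. -/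
def curvatureBar (d : ℕ) [NeZero d] : GaugeClass d →+ ExactG d :=
  QuotientAddGroup.lift (pureGauge d) (curvature d) (by
    rintro _ ⟨c, rfl⟩
    exact Subtype.ext (coboundary_coboundary ℤ U1 c))

/-- The infinite lattice measure `μ_{β,ℤ^d}` on `C^1/C^0`: the pushforward of the heat kernel
measure under the inverse of the map induced by the coboundary operator. -/
def latticeMeasure (d : ℕ) [NeZero d] (β : ℝ) : Measure (GaugeClass d) :=
  (heatKernelMeasure d β).map (Function.invFun (curvatureBar d))

/-- Translation of cochains by `a ∈ ℤ^d`. -/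
def translateCochain {k : ℕ} (a : Fin d → ℤ) :
    Cochain (lattice d) k U1 →+ Cochain (lattice d) k U1 where
  toFun c σ := c ⟨σ.1.shift (-a), trivial, σ.2.2⟩
  map_zero' := rfl
  map_add' _ _ := rfl

lemma translateCochain_coboundary {k : ℕ} (a : Fin d → ℤ) (c : Cochain (lattice d) k U1) :
    translateCochain a (coboundary ℤ (lattice d) k U1 c) =
      coboundary ℤ (lattice d) k U1 (translateCochain a c) := by
  funext σ
  change ∑ i ∈ σ.1.dirs.attach, _ = ∑ i ∈ σ.1.dirs.attach, _
  refine Finset.sum_congr rfl fun i _ => ?_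
  congr 2
  refine congrArg c (Subtype.ext (Cell.ext ?_ rfl))
  exact add_right_comm _ _ _

/-- The action of `a ∈ ℤ^d` on gauge classes by lattice translation. -/
def translateGaugeClass (a : Fin d → ℤ) : GaugeClass d →+ GaugeClass d :=
  QuotientAddGroup.map (pureGauge d) (pureGauge d) (translateCochain a) (by
    rintro _ ⟨c, rfl⟩
    exact ⟨translateCochain a c, (translateCochain_coboundary a c).symm⟩)

/-! ### Correlations of plaquette observables -/

/-- The 2-cells (plaquettes) of `ℤ^d`. -/
abbrev Plaquette (d : ℕ) : Type := (lattice d).Face 2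

/-- The plaquette `p + a`. -/
def Plaquette.shift (a : Fin d → ℤ) (p : Plaquette d) : Plaquette d :=
  ⟨p.1.shift a, trivial, p.2.2⟩

/-- The Wilson loop around the boundary of `p`, as a complex valued function of the gauge class: the
value at `p` of the coboundary, viewed in the unit circle through `t ↦ e^{2πit}`. -/
def wilson [NeZero d] (p : Plaquette d) (x : GaugeClass d) : ℂ :=
  (AddCircle.toCircle ((curvatureBar d x).1 p) : ℂ)

/-- The connected two point function `O_β(p, q)`. -/
def correlation [NeZero d] (β : ℝ) (p q : Plaquette d) : ℂ :=
  ∫ x, wilson p x * wilson q x ∂(latticeMeasure d β) -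
    (∫ x, wilson p x ∂(latticeMeasure d β)) * ∫ x, wilson q x ∂(latticeMeasure d β)

/-- A lattice direction: one of the vectors `±e_k`. -/
def IsLatticeDirection (e : Fin d → ℤ) : Prop :=
  ∃ k, e = Pi.single k 1 ∨ e = -Pi.single k 1

end LatticeGauge

end

/-!
Since `ℤ^d` satisfies the Poincaré lemma, and already the unit cubes among the admissible finite
subcomplexes contain every 3-cell, a 2-cochain lies in the projective limit of exact cochains if and
only if it is closed, if and only if it is a coboundary (`mem_limitExact_iff_isClosedCochain`,
`coboundary_axialPotential`). The unit cube is a manifold with boundary because it is homeomorphic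
to a Euclidean ball, for which inversions centred at two antipodal boundary points give charts
(`unitCube_mem_finiteSubcomplexes`).

Two probability measures on a compact Abelian group whose characters separate points agree as soon
as their Fourier transforms do, by Stone–Weierstrass. Conversely a limit of Fourier transforms of
probability measures is one, by compactness of the space of probability measures. Pushing forward
centred Gaussian measures of variance `2β` on finite-dimensional subspaces of the Hilbert space by
the exponential map, and exhausting by a Hilbert basis, gives the heat kernel measure
(`exists_isHeatKernelMeasure`). It is unique, hence inherits all symmetries of its Fourier
transform, in particular translation invariance.

The Wilson loop of a plaquette `p` is a character whose differential is `x ↦ x(p)`, represented in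
the Hilbert space by the orthogonal projection `P δ_p` of the indicator function of `p`. Therefore
the connected two-point function is, up to a factor bounded above and below,
`|exp(-8π²β G(p, q)) - 1|` with `G(p, q) = ⟨P δ_p, P δ_q⟩ = (P δ_p)(q)` (`norm_correlation`). Along a lattice direction
`G(p, p + ne)` tends to zero because `P δ_p` is square summable. For the lower bound one writes `P`
as the limit `ε → 0` of `d d^* (-Δ + ε)⁻¹`. On two parallel plaquettes in directions `i, j` the
kernel of this operator is `(∇_i^* ∇_i + ∇_j^* ∇_j) g_ε`, where `g_ε` is the Green function of
`-Δ + ε` on `ℤ^d` (`inner_approxProj`, `approxProj_plaq`), and the error is at most `ε^{1/4}` because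
`ε ‖g_ε‖² ≤ g_ε(0) ≤ ε^{-1/2} / 2`.

It remains to bound second differences of `g_ε` on a lattice axis. Solving the equation explicitly
in the axis direction and by Fourier series in the other ones shows that `g_ε` and all its second
differences `∇_l^* ∇_l g_ε` transverse to the axis are nonnegative on the axis, and the transverse
momenta of size `1/n` contribute at least `C / n^d` to the latter at distance `n`
(`exists_le_negLap_green`). If the axis is orthogonal to the plaquette this is all. Otherwise the
equation `(-Δ + ε) g_ε = 0` off the origin expresses `-(∇_i^* ∇_i + ∇_j^* ∇_j) g_ε` as a sum of
nonnegative terms, one of which is a transverse second difference because `d > 2`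
(`exists_le_abs_negLap_add_negLap`).
-/

noncomputable section

namespace LatticeGauge

/-! ### The closed unit cube as a topological manifold with boundary -/

/-- Inversion in the unit sphere centred at a point `p` of the unit sphere exchanges the closed unit
ball and a closed half-space, in coordinates relative to `p`. -/
lemma norm_inversion_le_iff {V : Type*} [NormedAddCommGroup V] [InnerProductSpace ℝ V] {p y : V}
    (hp : ‖p‖ = 1) (hy : y ≠ 0) :
    ‖p + (‖y‖ ^ 2)⁻¹ • y‖ ≤ 1 ↔ inner ℝ p y ≤ -1 / 2 := by
  have hy' : 0 < ‖y‖ ^ 2 := by positivity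
  rw [← sq_le_one_iff₀ (norm_nonneg _), norm_add_sq_real, hp, norm_smul, inner_smul_right,
    Real.norm_of_nonneg (by positivity)]
  have : 1 ^ 2 + 2 * ((‖y‖ ^ 2)⁻¹ * inner ℝ p y) + ((‖y‖ ^ 2)⁻¹ * ‖y‖) ^ 2 =
      1 + (‖y‖ ^ 2)⁻¹ * (2 * inner ℝ p y + 1) := by
    field_simp
    ring
  rw [this]
  constructor
  · intro h
    have : (‖y‖ ^ 2)⁻¹ * (2 * inner ℝ p y + 1) ≤ 0 := by linarith
    have h2 := nonpos_of_mul_nonpos_right this (by positivity)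
    linarith
  · intro h
    have : (‖y‖ ^ 2)⁻¹ * (2 * inner ℝ p y + 1) ≤ 0 :=
      mul_nonpos_of_nonneg_of_nonpos (by positivity) (by linarith)
    linarith

lemma inv_sq_norm_smul_inv_sq_norm_smul {V : Type*} [NormedAddCommGroup V] [NormedSpace ℝ V]
    (y : V) : (‖(‖y‖ ^ 2)⁻¹ • y‖ ^ 2)⁻¹ • ((‖y‖ ^ 2)⁻¹ • y) = y := by
  rcases eq_or_ne y 0 with rfl | hy
  · simp
  have hy' : ‖y‖ ≠ 0 := by simpa using hy
  rw [norm_smul, smul_smul, norm_inv, norm_pow, norm_norm]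
  convert one_smul ℝ y using 2
  field_simp

variable {d : ℕ}

section Ball

variable [NeZero d]

/-- The pole `s • e₀` of the unit sphere, for a sign `s`. -/
def ballPole (d : ℕ) [NeZero d] (s : ℝ) : EuclideanSpace ℝ (Fin d) :=
  s • EuclideanSpace.single 0 1

lemma norm_ballPole {s : ℝ} (hs : s ^ 2 = 1) : ‖ballPole d s‖ = 1 := by
  rw [ballPole, norm_smul, PiLp.norm_single, norm_one, mul_one, Real.norm_eq_abs]
  rcases sq_eq_one_iff.1 hs with rfl | rfl <;> simp

lemma ballChart_apply_nonneg {s : ℝ} (hs : s ^ 2 = 1) {x : EuclideanSpace ℝ (Fin d)}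
    (hx : ‖x‖ ≤ 1) (h : x ≠ ballPole d s) :
    0 ≤ (-s • ((‖x - ballPole d s‖ ^ 2)⁻¹ • (x - ballPole d s)) -
      (1 / 2 : ℝ) • EuclideanSpace.single 0 1 : EuclideanSpace ℝ (Fin d)) 0 := by
  have hx' : x - ballPole d s ≠ 0 := sub_ne_zero.2 h
  have h0 : (‖x - ballPole d s‖ ^ 2)⁻¹ • (x - ballPole d s) ≠ 0 := by
    have : ‖x - ballPole d s‖ ≠ 0 := norm_ne_zero_iff.2 hx'
    exact smul_ne_zero (by positivity) hx'
  have := (norm_inversion_le_iff (norm_ballPole hs) h0).1 (by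
    rw [inv_sq_norm_smul_inv_sq_norm_smul]
    simpa using hx)
  nth_rw 1 [ballPole] at this
  rw [inner_smul_left, EuclideanSpace.inner_single_left] at this
  simp only [map_one, one_mul, conj_trivial] at this
  simp at this ⊢
  linarith

lemma ballChart_symm_ne_zero {s : ℝ} (hs : s ^ 2 = 1) (z : EuclideanHalfSpace d) :
    -s • (z.1 + (1 / 2 : ℝ) • EuclideanSpace.single 0 1) ≠ 0 := by
  have hz := z.2
  have hs0 : s ≠ 0 := by rintro rfl; simp at hs
  intro h
  have := congrArg (fun v : EuclideanSpace ℝ (Fin d) => v 0) h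
  simp only [PiLp.smul_apply, PiLp.add_apply, PiLp.zero_apply, PiLp.single_apply, if_true,
    smul_eq_mul, mul_eq_zero, neg_eq_zero, hs0, false_or] at this
  linarith

/-- The chart of the closed unit ball around every point other than the pole `p = ± e₀`: inversion
in a sphere centred at `p` takes the ball without `p` to a closed half-space. -/
def ballChart (s : ℝ) (hs : s ^ 2 = 1) :
    OpenPartialHomeomorph (Metric.closedBall (0 : EuclideanSpace ℝ (Fin d)) 1)
      (EuclideanHalfSpace d) where
  toFun x := if h : x.1 = ballPole d s then 0 else
    ⟨-s • ((‖x.1 - ballPole d s‖ ^ 2)⁻¹ • (x.1 - ballPole d s)) -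
      (1 / 2 : ℝ) • EuclideanSpace.single 0 1,
      ballChart_apply_nonneg hs (mem_closedBall_zero_iff.1 x.2) h⟩
  invFun z := ⟨ballPole d s + (‖-s • (z.1 + (1 / 2 : ℝ) • EuclideanSpace.single 0 1)‖ ^ 2)⁻¹ •
      (-s • (z.1 + (1 / 2 : ℝ) • EuclideanSpace.single 0 1)), by
      have hz := z.2
      rw [mem_closedBall_zero_iff,
        norm_inversion_le_iff (norm_ballPole hs) (ballChart_symm_ne_zero hs z),
        ballPole, inner_smul_left, EuclideanSpace.inner_single_left]
      simp
      nlinarith [hs, hz]⟩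
  source := {x | x.1 ≠ ballPole d s}
  target := Set.univ
  map_source' _ _ := trivial
  map_target' z _ := by
    have h0 := ballChart_symm_ne_zero hs z
    have h1 := norm_ne_zero_iff.2 h0
    simp only [ne_eq, Set.mem_ofPred_eq, add_eq_left]
    exact smul_ne_zero (inv_ne_zero (pow_ne_zero 2 h1)) h0
  left_inv' x hx := by
    have hx : x.1 ≠ ballPole d s := hx
    apply Subtype.ext
    simp only [dif_neg hx, sub_add_cancel]
    rw [smul_smul (-s) (-s), neg_mul_neg, ← sq, hs, one_smul, inv_sq_norm_smul_inv_sq_norm_smul]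
    simp
  right_inv' z _ := by
    have h0 := ballChart_symm_ne_zero hs z
    have h1 := norm_ne_zero_iff.2 h0
    rw [dif_neg]
    · apply Subtype.ext
      simp only [add_sub_cancel_left]
      rw [inv_sq_norm_smul_inv_sq_norm_smul, smul_smul, neg_mul_neg, ← sq, hs, one_smul,
        add_sub_cancel_right]
    · simp only [add_eq_left]
      exact smul_ne_zero (inv_ne_zero (pow_ne_zero 2 h1)) h0
  open_source := isOpen_ne.preimage continuous_subtype_val
  open_target := isOpen_univ
  continuousOn_toFun := by
    rw [continuousOn_iff_continuous_domRestrict]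
    have hc : Continuous fun x : {x : Metric.closedBall
      (0 : EuclideanSpace ℝ (Fin d)) 1 // x.1 ≠ ballPole d s} =>
        -s • ((‖x.1.1 - ballPole d s‖ ^ 2)⁻¹ • (x.1.1 - ballPole d s)) -
      (1 / 2 : ℝ) • EuclideanSpace.single 0 1 := by
      have : ∀ x : {x : Metric.closedBall
        (0 : EuclideanSpace ℝ (Fin d)) 1 // x.1 ≠ ballPole d s},
          ‖x.1.1 - ballPole d s‖ ^ 2 ≠ 0 := fun x =>
        pow_ne_zero _ (norm_ne_zero_iff.2 (sub_ne_zero.2 x.2))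
      fun_prop (disch := assumption)
    have hc' : Continuous fun x : {x : Metric.closedBall
      (0 : EuclideanSpace ℝ (Fin d)) 1 // x.1 ≠ ballPole d s} =>
        (⟨-s • ((‖x.1.1 - ballPole d s‖ ^ 2)⁻¹ • (x.1.1 - ballPole d s)) -
          (1 / 2 : ℝ) • EuclideanSpace.single 0 1, ballChart_apply_nonneg hs
            (mem_closedBall_zero_iff.1 x.1.2) x.2⟩ : EuclideanHalfSpace d) := hc.subtype_mk _
    refine hc'.congr ?_
    intro x
    have hx : x.1.1 ≠ ballPole d s := x.2
    simp only [Set.domRestrict_apply, dif_neg hx]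
  continuousOn_invFun := by
    apply Continuous.continuousOn
    refine Continuous.subtype_mk ?_ _
    have : ∀ z : EuclideanHalfSpace d,
        ‖-s • (z.1 + (1 / 2 : ℝ) • EuclideanSpace.single 0 1)‖ ^ 2 ≠ 0 := fun z =>
      pow_ne_zero _ (norm_ne_zero_iff.2 (ballChart_symm_ne_zero hs z))
    have h3 : Continuous fun z : EuclideanHalfSpace d => z.1 := continuous_subtype_val
    fun_prop (disch := assumption)

/-- The closed unit ball is a manifold with boundary: the charts centred at the two poles `± e₀`
cover it. -/
lemma nonempty_chartedSpace_closedBall : Nonempty (ChartedSpace (EuclideanHalfSpace d)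
    (Metric.closedBall (0 : EuclideanSpace ℝ (Fin d)) 1)) := by
  classical
  exact ⟨
  { atlas := {ballChart 1 (by norm_num), ballChart (-1) (by norm_num)}
    chartAt x := if x.1 = ballPole d 1 then ballChart (-1) (by norm_num)
      else ballChart 1 (by norm_num)
    mem_chart_source x := by
      by_cases h : x.1 = ballPole d 1
      · rw [if_pos h]
        change x.1 ≠ ballPole d (-1)
        rw [h]
        intro h
        have := congrArg (fun v : EuclideanSpace ℝ (Fin d) => v 0) h
        simp [ballPole] at this
        linarith
      · rw [if_neg h]
        exact h
    chart_mem_atlas x := by split_ifs <;> simp }⟩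

/-- Transport of a charted space structure along a homeomorphism. -/
lemma nonempty_chartedSpace_of_homeomorph {H X Y : Type*} [TopologicalSpace H] [TopologicalSpace X]
    [TopologicalSpace Y] (e : X ≃ₜ Y) (h : Nonempty (ChartedSpace H Y)) :
    Nonempty (ChartedSpace H X) := by
  obtain ⟨h⟩ := h
  exact ⟨{
    atlas := (fun c => e.toOpenPartialHomeomorph.trans c) '' atlas H Y
    chartAt x := e.toOpenPartialHomeomorph.trans (chartAt H (e x))
    mem_chart_source x := by simp
    chart_mem_atlas x := ⟨_, chart_mem_atlas H (e x), rfl⟩ }⟩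

lemma nonempty_chartedSpace_unitCube (v : Fin d → ℝ) :
    Nonempty (ChartedSpace (EuclideanHalfSpace d) (Set.Icc v (v + 1))) := by
  have hd : Nonempty (Fin d) := ⟨0⟩
  let L := (EuclideanSpace.equiv (Fin d) ℝ)
  let s : Set (EuclideanSpace ℝ (Fin d)) := L ⁻¹' Set.Icc v (v + 1)
  have hs : s = L.toHomeomorph ⁻¹' Set.Icc v (v + 1) := rfl
  have hc : Convex ℝ s := (convex_Icc v (v + 1)).linear_preimage L.toLinearMap
  have hcl : IsClosed s := isClosed_Icc.preimage L.continuous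
  have hne : (interior s).Nonempty := by
    rw [hs, ← Homeomorph.preimage_interior]
    refine ⟨L.symm (v + fun _ => 1 / 2), ?_⟩
    rw [← Set.pi_univ_Icc, interior_pi_set Set.finite_univ]
    intro i _
    change v i + 1 / 2 ∈ interior (Set.Icc (v i) (v i + 1))
    rw [interior_Icc]
    change v i < v i + 1 / 2 ∧ v i + 1 / 2 < v i + 1
    constructor <;> linarith
  have hb : Bornology.IsBounded s := by
    have : IsCompact s := (L.toHomeomorph.isCompact_preimage).2 isCompact_Icc
    exact this.isBounded
  obtain ⟨h, -, hh, -⟩ := exists_homeomorph_image_interior_closure_frontier_eq_unitBall hc hne hb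
  rw [hcl.closure_eq] at hh
  have e1 : Set.Icc v (v + 1) ≃ₜ s := (L.toHomeomorph.subtype (fun x => Iff.rfl)).symm
  have e2 : s ≃ₜ Metric.closedBall (0 : EuclideanSpace ℝ (Fin d)) 1 :=
    (h.image s).trans (Homeomorph.setCongr hh)
  exact nonempty_chartedSpace_of_homeomorph (e1.trans e2) nonempty_chartedSpace_closedBall

end Ball

/-- The subcomplex of all faces of the top-dimensional cube with lowest vertex `v`. -/
def unitCube (v : Fin d → ℤ) : Subcomplex d where
  cells := {σ | ∀ i, v i ≤ σ.base i ∧ σ.base i + (if i ∈ σ.dirs then 1 else 0) ≤ v i + 1}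
  back_mem σ hσ i hi j := by
    have := hσ j
    simp only [Cell.back, Finset.mem_erase]
    split_ifs at * <;> grind
  front_mem σ hσ i hi j := by
    have := hσ j
    have hi' := hσ i
    simp only [Cell.front, Finset.mem_erase, Pi.add_apply, Pi.single_apply]
    split_ifs at * <;> grind

lemma unitCube_space (v : Fin d → ℤ) :
    (unitCube v).space = Set.Icc (fun i => (v i : ℝ)) ((fun i => (v i : ℝ)) + 1) := by
  ext x
  simp only [Subcomplex.space, Set.mem_iUnion, exists_prop, Set.mem_Icc, Pi.le_def, Pi.add_apply,
    Pi.one_apply]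
  constructor
  · rintro ⟨σ, hσ, hx⟩
    constructor
    · intro i
      have := (hσ i).1
      have h2 := (hx i).1
      have : (v i : ℝ) ≤ σ.base i := by exact_mod_cast this
      linarith
    · intro i
      have := (hσ i).2
      have h2 := (hx i).2
      have : (σ.base i : ℝ) + (if i ∈ σ.dirs then 1 else 0) ≤ v i + 1 := by exact_mod_cast this
      linarith
  · rintro ⟨h1, h2⟩
    refine ⟨⟨v, Finset.univ⟩, fun i => by simp, fun i => ?_⟩
    simpa using ⟨h1 i, h2 i⟩

lemma unitCube_cells_finite (v : Fin d → ℤ) : (unitCube v).cells.Finite := by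
  have : Set.Finite ((fun q : (Fin d → ℤ) × Finset (Fin d) => (⟨q.1, q.2⟩ : Cell d)) ''
      (Set.Icc v (v + 1) ×ˢ Set.univ)) :=
    ((Set.finite_Icc v (v + 1)).prod Set.finite_univ).image _
  refine this.subset fun σ hσ => ⟨(σ.base, σ.dirs), ⟨⟨fun i => (hσ i).1, fun i => ?_⟩, trivial⟩, rfl⟩
  have := (hσ i).2
  simp only [Pi.add_apply, Pi.one_apply]
  split_ifs at this <;> omega

lemma unitCube_mem_finiteSubcomplexes [NeZero d] (v : Fin d → ℤ) :
    unitCube v ∈ finiteSubcomplexes d := by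
  refine ⟨unitCube_cells_finite v, ?_, ?_⟩
  · rw [unitCube_space]
    refine (convex_Icc _ _).contractibleSpace ⟨fun i => (v i : ℝ), le_rfl, ?_⟩
    intro i
    simp
  · rw [unitCube_space]
    exact nonempty_chartedSpace_unitCube _

/-! ### Cochains in coordinates -/

/-- The vertex `v`. -/
def vertex (v : Fin d → ℤ) : (lattice d).Face 0 := ⟨⟨v, ∅⟩, trivial, rfl⟩

/-- The edge from `v` to `v + e_i`. -/
def edge (v : Fin d → ℤ) (i : Fin d) : (lattice d).Face 1 :=
  ⟨⟨v, {i}⟩, trivial, Finset.card_singleton i⟩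

/-- The plaquette with lowest vertex `v` spanned by `e_a` and `e_b`. -/
def plaq (v : Fin d → ℤ) (a b : Fin d) (h : a ≠ b) : Plaquette d :=
  ⟨⟨v, {a, b}⟩, trivial, Finset.card_pair h⟩

lemma eq_vertex (σ : (lattice d).Face 0) : σ = vertex σ.1.base :=
  Subtype.ext (Cell.ext rfl (Finset.card_eq_zero.1 σ.2.2))

lemma exists_eq_edge (σ : (lattice d).Face 1) : ∃ i, σ = edge σ.1.base i := by
  obtain ⟨i, hi⟩ := Finset.card_eq_one.1 σ.2.2
  exact ⟨i, Subtype.ext (Cell.ext rfl hi)⟩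

lemma exists_eq_plaq (p : Plaquette d) : ∃ a b, ∃ h : a < b, p = plaq p.1.base a b h.ne := by
  obtain ⟨i, j, hij, hS⟩ := Finset.card_eq_two.1 p.2.2
  rcases lt_or_gt_of_ne hij with h | h
  · exact ⟨i, j, h, Subtype.ext (Cell.ext rfl hS)⟩
  · exact ⟨j, i, h, Subtype.ext (Cell.ext rfl (by rw [hS, Finset.pair_comm]; rfl))⟩

section Coboundary

variable (R : Type*) [CommRing R] {A : Type*} [AddCommGroup A] [Module R A]

lemma coboundary_edge (c : Cochain (lattice d) 0 A) (v : Fin d → ℤ) (i : Fin d) :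
    coboundary R (lattice d) 0 A c (edge v i) =
      c (vertex (v + Pi.single i 1)) - c (vertex v) := by
  let g : (Fin d → ℤ) → A := fun v => c (vertex v)
  have hg : ∀ σ, c σ = g σ.1.base := fun σ => congrArg c (eq_vertex σ)
  have : coboundary R (lattice d) 0 A c (edge v i) = ∑ l ∈ ({i} : Finset (Fin d)),
      ((-1 : ℤ) ^ (({i} : Finset (Fin d)).filter (· < l)).card) •
        (g (v + Pi.single l 1) - g v) := by
    simp only [coboundary, LinearMap.coe_mk, AddHom.coe_mk]
    rw [← Finset.sum_attach ({i} : Finset (Fin d))]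
    refine Finset.sum_congr rfl fun l _ => ?_
    rw [hg, hg]
    rfl
  rw [this]
  simp [g, Finset.filter_singleton]

lemma coboundary_plaq (c : Cochain (lattice d) 1 A) (v : Fin d → ℤ) {a b : Fin d} (h : a < b) :
    coboundary R (lattice d) 1 A c (plaq v a b h.ne) =
      (c (edge (v + Pi.single a 1) b) - c (edge v b)) -
        (c (edge (v + Pi.single b 1) a) - c (edge v a)) := by
  classical
  let g : (Fin d → ℤ) → Finset (Fin d) → A :=
    fun v S => if hS : S.card = 1 then c ⟨⟨v, S⟩, trivial, hS⟩ else 0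
  have hg : ∀ v i, g v {i} = c (edge v i) := fun v i => dif_pos (Finset.card_singleton i)
  have hg' : ∀ σ : (lattice d).Face 1, c σ = g σ.1.base σ.1.dirs := fun σ => by
    simp only [g, dif_pos σ.2.2]
  have : coboundary R (lattice d) 1 A c (plaq v a b h.ne) = ∑ l ∈ ({a, b} : Finset (Fin d)),
      ((-1 : ℤ) ^ (({a, b} : Finset (Fin d)).filter (· < l)).card) •
        (g (v + Pi.single l 1) (({a, b} : Finset (Fin d)).erase l) -
          g v (({a, b} : Finset (Fin d)).erase l)) := by
    change ∑ i ∈ (plaq v a b h.ne).1.dirs.attach, _ = _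
    rw [← Finset.sum_attach ({a, b} : Finset (Fin d))]
    refine Finset.sum_congr rfl fun l _ => ?_
    rw [hg', hg']
    rfl
  have e1 : ({a, b} : Finset (Fin d)).erase a = {b} := by
    ext x; simp only [Finset.mem_erase, Finset.mem_insert, Finset.mem_singleton]; grind
  have e2 : ({a, b} : Finset (Fin d)).erase b = {a} := by
    ext x; simp only [Finset.mem_erase, Finset.mem_insert, Finset.mem_singleton]; grind
  have f1 : ({a, b} : Finset (Fin d)).filter (· < a) = ∅ := by
    ext x; simp only [Finset.mem_filter, Finset.mem_insert, Finset.mem_singleton]; grind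
  have f2 : ({a, b} : Finset (Fin d)).filter (· < b) = {a} := by
    ext x; simp only [Finset.mem_filter, Finset.mem_insert, Finset.mem_singleton]; grind
  rw [this, Finset.sum_pair h.ne, e1, e2, f1, f2]
  simp only [hg, Finset.card_empty, Finset.card_singleton, pow_zero, pow_one, one_smul, neg_smul]
  abel

end Coboundary

/-- The antisymmetric components `F_{ab}(v)` of a 2-cochain. -/
def comp {A : Type*} [AddCommGroup A] (c : Cochain (lattice d) 2 A) (a b : Fin d)
    (v : Fin d → ℤ) : A :=
  if h : a < b then c (plaq v a b h.ne) else if h : b < a then -c (plaq v b a h.ne) else 0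

section Comp

variable {A : Type*} [AddCommGroup A]

lemma comp_of_lt (c : Cochain (lattice d) 2 A) {a b : Fin d} (h : a < b) (v : Fin d → ℤ) :
    comp c a b v = c (plaq v a b h.ne) := dif_pos h

lemma comp_self (c : Cochain (lattice d) 2 A) (a : Fin d) (v : Fin d → ℤ) :
    comp c a a v = 0 := by simp [comp]

lemma comp_swap (c : Cochain (lattice d) 2 A) (a b : Fin d) (v : Fin d → ℤ) :
    comp c b a v = -comp c a b v := by
  rcases lt_trichotomy a b with h | rfl | h
  · simp [comp, h, h.not_gt]
  · simp [comp]
  · simp [comp, h, h.not_gt]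

lemma comp_coboundary (R : Type*) [CommRing R] [Module R A] (c : Cochain (lattice d) 1 A)
    (a b : Fin d) (v : Fin d → ℤ) :
    comp (coboundary R (lattice d) 1 A c) a b v =
      (c (edge (v + Pi.single a 1) b) - c (edge v b)) -
        (c (edge (v + Pi.single b 1) a) - c (edge v a)) := by
  rcases lt_trichotomy a b with h | rfl | h
  · rw [comp_of_lt _ h, coboundary_plaq R c v h]
  · rw [comp_self]; abel
  · rw [comp_swap, comp_of_lt _ h, coboundary_plaq R c v h]; abel

/-- A 2-cochain on the lattice is closed: its coboundary, written in antisymmetric components,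
vanishes. -/
def IsClosedCochain (c : Cochain (lattice d) 2 A) : Prop :=
  ∀ a b e v, (comp c a b (v + Pi.single e 1) - comp c a b v) +
    (comp c b e (v + Pi.single a 1) - comp c b e v) +
    (comp c e a (v + Pi.single b 1) - comp c e a v) = 0

/-- Exactness on the unit cubes alone forces closedness, since every 3-cell lies in one of them. -/
lemma isClosedCochain_of_mem_limitExact [NeZero d] {R : Type*} [CommRing R] [Module R A]
    {c : Cochain (lattice d) 2 A} (hc : c ∈ limitExact d R A) : IsClosedCochain c := by
  classical
  intro a b e v
  by_cases hab : a = b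
  · subst hab
    rw [comp_self, comp_self, comp_swap c a e, comp_swap c a e]; abel
  by_cases hbe : b = e
  · subst hbe
    rw [comp_self, comp_self, comp_swap c a b, comp_swap c a b]; abel
  by_cases hae : a = e
  · subst hae
    rw [comp_self, comp_self, comp_swap c a b, comp_swap c a b]; abel
  obtain ⟨α, hα⟩ := mem_limitExact.1 hc _ (unitCube_mem_finiteSubcomplexes v)
  let α' : Cochain (lattice d) 1 A := fun σ =>
    if h : σ.1 ∈ (unitCube v).cells then α ⟨σ.1, h, σ.2.2⟩ else 0
  have hα' : restrict R (unitCube v) 1 A α' = α := by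
    funext σ
    exact dif_pos σ.2.1
  rw [← hα', ← restrict_coboundary] at hα
  have hmem : ∀ p : Plaquette d, p.1 ∈ (unitCube v).cells →
      c p = coboundary R (lattice d) 1 A α' p := fun p hp =>
    (congrFun hα ⟨p.1, hp, p.2.2⟩).symm
  have key0 : ∀ i j, comp c i j v = comp (coboundary R (lattice d) 1 A α') i j v := by
    intro i j
    have : ∀ i j (h : i ≠ j), (plaq v i j h).1 ∈ (unitCube v).cells := by
      intro i j h l
      simp only [plaq]
      split_ifs <;> omega
    unfold comp
    split_ifs with h1 h2
    · exact hmem _ (this i j h1.ne)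
    · rw [hmem _ (this j i h2.ne)]
    · rfl
  have key1 : ∀ i j k, k ≠ i → k ≠ j → comp c i j (v + Pi.single k 1) =
      comp (coboundary R (lattice d) 1 A α') i j (v + Pi.single k 1) := by
    intro i j k hi hj
    have : ∀ i j (h : i ≠ j), k ≠ i → k ≠ j →
        (plaq (v + Pi.single k 1) i j h).1 ∈ (unitCube v).cells := by
      intro i j h hi hj l
      simp only [plaq, Pi.add_apply, Pi.single_apply, Finset.mem_insert, Finset.mem_singleton]
      split_ifs <;> grind
    unfold comp
    split_ifs with h1 h2
    · exact hmem _ (this i j h1.ne hi hj)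
    · rw [hmem _ (this j i h2.ne hj hi)]
    · rfl
  rw [key0, key0, key0, key1 _ _ _ (Ne.symm hae) (Ne.symm hbe), key1 _ _ _ hab hae,
    key1 _ _ _ hbe (Ne.symm hab)]
  simp only [comp_coboundary]
  rw [add_right_comm v (Pi.single e 1) (Pi.single a 1),
    add_right_comm v (Pi.single e 1) (Pi.single b 1),
    add_right_comm v (Pi.single a 1) (Pi.single b 1)]
  abel

end Comp

/-! ### The Poincaré lemma on `ℤ^d` -/

section Poincare

variable {A : Type*} [AddCommGroup A]

/-- The discrete antiderivative of `f`, vanishing at `0`. -/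
def antidiff (f : ℤ → A) (n : ℤ) : A :=
  ∑ t ∈ Finset.Ico 0 n, f t - ∑ t ∈ Finset.Ico n 0, f t

lemma antidiff_zero (f : ℤ → A) : antidiff f 0 = 0 := by simp [antidiff]

lemma antidiff_succ (f : ℤ → A) (n : ℤ) : antidiff f (n + 1) = antidiff f n + f n := by
  unfold antidiff
  rcases le_or_gt 0 n with h | h
  · have : Finset.Ico 0 (n + 1) = insert n (Finset.Ico 0 n) := by
      ext x; simp only [Finset.mem_Ico, Finset.mem_insert]; omega
    rw [this, Finset.sum_insert (by simp), Finset.Ico_eq_empty (by omega : ¬ n < 0),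
      Finset.Ico_eq_empty (by omega : ¬ n + 1 < 0)]
    simp [add_comm]
  · have : Finset.Ico n 0 = insert n (Finset.Ico (n + 1) 0) := by
      ext x; simp only [Finset.mem_Ico, Finset.mem_insert]; omega
    rw [this, Finset.sum_insert (by simp), Finset.Ico_eq_empty (by omega : ¬ (0 : ℤ) < n + 1),
      Finset.Ico_eq_empty (by omega : ¬ (0 : ℤ) < n)]
    simp

lemma antidiff_diff (g : ℤ → A) (n : ℤ) : antidiff (fun t => g (t + 1) - g t) n = g n - g 0 := by
  induction n using Int.induction_on with
  | zero => simp [antidiff_zero]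
  | succ n ih => rw [antidiff_succ, ih]; abel
  | pred n ih =>
    have := antidiff_succ (fun t => g (t + 1) - g t) (-n - 1)
    rw [sub_add_cancel, ih] at this
    rw [eq_sub_of_add_eq this.symm]
    abel

lemma antidiff_sub (f g : ℤ → A) (n : ℤ) :
    antidiff (fun t => f t - g t) n = antidiff f n - antidiff g n := by
  simp only [antidiff, Finset.sum_sub_distrib]; abel

/-- Set the coordinates with index less than `m` to zero. -/
def trunc (m : ℕ) (v : Fin d → ℤ) : Fin d → ℤ := fun i => if i.val < m then 0 else v i

/-- Integration of `f` along the segment in direction `j` that ends at `v` with its first `j`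
coordinates set to zero. -/
def segInt (j : Fin d) (f : (Fin d → ℤ) → A) (v : Fin d → ℤ) : A :=
  antidiff (fun t => f (Function.update (trunc j v) j t)) (v j)

lemma trunc_add_single_of_lt {i : Fin d} {m : ℕ} (h : i.val < m) (v : Fin d → ℤ) (n : ℤ) :
    trunc m (v + Pi.single i n) = trunc m v := by
  funext l
  by_cases hl : l.val < m
  · simp [trunc, hl]
  · have : l ≠ i := by rintro rfl; exact hl h
    simp [trunc, hl, this]

lemma trunc_add_single_of_le {i : Fin d} {m : ℕ} (h : m ≤ i.val) (v : Fin d → ℤ) (n : ℤ) :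
    trunc m (v + Pi.single i n) = trunc m v + Pi.single i n := by
  funext l
  by_cases hl : l.val < m
  · have : l ≠ i := by rintro rfl; omega
    simp [trunc, hl, this]
  · simp [trunc, hl]

lemma update_trunc_self (j : Fin d) (v : Fin d → ℤ) :
    Function.update (trunc j v) j (v j) = trunc j v := by
  rw [Function.update_eq_self_iff]
  simp [trunc]

lemma update_trunc_zero (j : Fin d) (v : Fin d → ℤ) :
    Function.update (trunc j v) j 0 = trunc (j + 1) v := by
  funext l
  by_cases hl : l = j
  · subst hl; simp [trunc]
  · have : l.val ≠ j.val := fun h => hl (Fin.ext h)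
    have h2 : l.val < j.val + 1 ↔ l.val < j.val := by omega
    simp [trunc, hl, h2]

lemma segInt_add_single_of_lt {i j : Fin d} (h : i < j) (f : (Fin d → ℤ) → A) (v : Fin d → ℤ) :
    segInt j f (v + Pi.single i 1) = segInt j f v := by
  unfold segInt
  rw [trunc_add_single_of_lt h]
  simp [h.ne']

lemma segInt_add_single_self (j : Fin d) (f : (Fin d → ℤ) → A) (v : Fin d → ℤ) :
    segInt j f (v + Pi.single j 1) - segInt j f v = f (trunc j v) := by
  unfold segInt
  have : ∀ t, Function.update (trunc j (v + Pi.single j 1)) j t =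
      Function.update (trunc j v) j t := by
    intro t
    funext l
    by_cases hl : l = j
    · subst hl; simp
    · simp [hl, trunc]
  simp only [this, Pi.add_apply, Pi.single_eq_same]
  rw [antidiff_succ, update_trunc_self]
  abel

lemma segInt_add_single_of_gt {i j : Fin d} (h : j < i) (f : (Fin d → ℤ) → A) (v : Fin d → ℤ) :
    segInt j f (v + Pi.single i 1) - segInt j f v =
      segInt j (fun w => f (w + Pi.single i 1) - f w) v := by
  unfold segInt
  have : ∀ t, Function.update (trunc j (v + Pi.single i 1)) j t =
      Function.update (trunc j v) j t + Pi.single i 1 := by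
    intro t
    rw [trunc_add_single_of_le (le_of_lt h)]
    funext l
    by_cases hl : l = j
    · subst hl; simp [h.ne]
    · simp [hl]
  simp only [this, Pi.add_apply, Pi.single_eq_of_ne h.ne, add_zero]
  rw [antidiff_sub]

lemma segInt_diff (j : Fin d) (f : (Fin d → ℤ) → A) (v : Fin d → ℤ) :
    segInt j (fun w => f (w + Pi.single j 1) - f w) v = f (trunc j v) - f (trunc (j + 1) v) := by
  unfold segInt
  have : ∀ t, Function.update (trunc j v) j t + Pi.single j 1 =
      Function.update (trunc j v) j (t + 1) := by
    intro t
    funext l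
    by_cases hl : l = j
    · subst hl; simp
    · simp [hl]
  simp only [this]
  rw [antidiff_diff (fun t => f (Function.update (trunc j v) j t)), update_trunc_self,
    update_trunc_zero]

lemma segInt_sub (j : Fin d) (f g : (Fin d → ℤ) → A) (v : Fin d → ℤ) :
    segInt j (fun w => f w - g w) v = segInt j f v - segInt j g v := antidiff_sub _ _ _

/-- Telescoping along the path from `0` to `v` that moves in one coordinate direction at a time. -/
lemma sum_trunc_telescope (i : Fin d) (f : (Fin d → ℤ) → A) (v : Fin d → ℤ) :
    ∑ j : Fin d, (if j < i then f (trunc j v) - f (trunc (j + 1) v)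
      else if j = i then f (trunc i v) else 0) = f v := by
  have h1 : ∑ j : Fin d, (if j < i then f (trunc j v) - f (trunc (j + 1) v)
      else if j = i then f (trunc i v) else 0) =
      ∑ j : Fin d, (fun m : ℕ => if m < i.val then f (trunc m v) - f (trunc (m + 1) v)
      else if m = i.val then f (trunc i v) else 0) j := by
    refine Finset.sum_congr rfl fun j _ => ?_
    simp only [Fin.lt_def, Fin.ext_iff]
  rw [h1, Fin.sum_univ_eq_sum_range (fun m : ℕ => if m < i.val then
    f (trunc m v) - f (trunc (m + 1) v) else if m = i.val then f (trunc i v) else 0)]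
  have h2 : ∀ m ∈ Finset.range d, m ∉ Finset.range (i.val + 1) → (if m < i.val then
      f (trunc m v) - f (trunc (m + 1) v) else if m = i.val then f (trunc i v) else 0) = 0 := by
    intro m _ hm
    rw [Finset.mem_range] at hm
    rw [if_neg (by omega), if_neg (by omega)]
  rw [← Finset.sum_subset (by intro m; simp only [Finset.mem_range]; omega) h2,
    Finset.sum_range_succ, Finset.sum_congr rfl (fun m hm => if_pos (Finset.mem_range.1 hm)),
    Finset.sum_range_sub' (fun m => f (trunc m v))]
  have h3 : trunc 0 v = v := by funext l; simp [trunc]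
  simp [h3]

/-- The direction of an edge. -/
def edgeDir (σ : (lattice d).Face 1) : Fin d := (exists_eq_edge σ).choose

lemma edgeDir_edge (v : Fin d → ℤ) (i : Fin d) : edgeDir (edge v i) = i := by
  have := (exists_eq_edge (edge v i)).choose_spec
  have h2 := congrArg (fun σ : (lattice d).Face 1 => σ.1.dirs) this
  exact (Finset.singleton_injective h2).symm

/-- The axial gauge: a potential of a closed 2-cochain which vanishes on the edges in direction `i`
whose first `i` coordinates are zero. -/
def axialPotential (c : Cochain (lattice d) 2 A) : Cochain (lattice d) 1 A := fun σ =>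
  ∑ j : Fin d, if j < edgeDir σ then segInt j (comp c j (edgeDir σ)) σ.1.base else 0

lemma axialPotential_edge (c : Cochain (lattice d) 2 A) (v : Fin d → ℤ) (i : Fin d) :
    axialPotential c (edge v i) = ∑ j : Fin d, if j < i then segInt j (comp c j i) v else 0 := by
  unfold axialPotential
  rw [edgeDir_edge]
  rfl

lemma coboundary_axialPotential (R : Type*) [CommRing R] [Module R A]
    {c : Cochain (lattice d) 2 A} (hc : IsClosedCochain c) :
    coboundary R (lattice d) 1 A (axialPotential c) = c := by
  funext p
  obtain ⟨i, k, hik, hp⟩ := exists_eq_plaq p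
  generalize p.1.base = v at hp
  subst hp
  rw [coboundary_plaq R _ v hik]
  simp only [axialPotential_edge]
  rw [← Finset.sum_sub_distrib, ← Finset.sum_sub_distrib, ← Finset.sum_sub_distrib,
    ← comp_of_lt c hik, ← sum_trunc_telescope i (comp c i k) v]
  refine Finset.sum_congr rfl fun j _ => ?_
  rcases lt_trichotomy j i with h | rfl | h
  · have hjk := h.trans hik
    simp only [if_pos h, if_pos hjk]
    rw [segInt_add_single_of_gt h, segInt_add_single_of_gt hjk, ← segInt_sub, ← segInt_diff]
    congr 1
    funext w
    have := hc j k i w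
    rw [comp_swap c i k, comp_swap c i k, comp_swap c j i, comp_swap c j i] at this
    rw [← sub_eq_zero, ← this]
    abel
  · simp only [if_pos hik, lt_irrefl, if_false, if_true, sub_self, sub_zero]
    exact segInt_add_single_self _ _ _
  · simp only [h.not_gt, h.ne', if_false, sub_self, sub_zero]
    split_ifs with hjk
    · rw [segInt_add_single_of_lt h, sub_self]
    · simp

/-- A flat 1-cochain is a pure gauge: integrate it along the path from `0` to `v` that moves in one
coordinate direction at a time. -/
lemma exists_coboundary_eq_of_coboundary_eq_zero (R : Type*) [CommRing R] [Module R A]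
    {α : Cochain (lattice d) 1 A} (hα : coboundary R (lattice d) 1 A α = 0) :
    ∃ φ, coboundary R (lattice d) 0 A φ = α := by
  refine ⟨fun σ => ∑ j : Fin d, segInt j (fun w => α (edge w j)) σ.1.base, ?_⟩
  funext σ
  obtain ⟨i, hσ⟩ := exists_eq_edge σ
  generalize σ.1.base = v at hσ
  subst hσ
  rw [coboundary_edge]
  simp only [vertex]
  rw [← Finset.sum_sub_distrib]
  conv_rhs => rw [← sum_trunc_telescope i (fun w => α (edge w i)) v]
  refine Finset.sum_congr rfl fun j _ => ?_
  rcases lt_trichotomy j i with h | rfl | h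
  · simp only [if_pos h]
    rw [segInt_add_single_of_gt h, ← segInt_diff j (fun w => α (edge w i))]
    congr 1
    funext w
    have := comp_coboundary R α i j w
    rw [hα] at this
    rw [← sub_eq_zero, ← this]
    simp [comp]
  · simp only [lt_irrefl, if_false, if_true]
    exact segInt_add_single_self _ _ _
  · simp only [h.not_gt, h.ne', if_false]
    rw [segInt_add_single_of_lt h, sub_self]

lemma coboundary_mem_limitExact [NeZero d] (R : Type*) [CommRing R] [Module R A]
    (α : Cochain (lattice d) 1 A) : coboundary R (lattice d) 1 A α ∈ limitExact d R A :=
  mem_limitExact.2 fun K _ => ⟨restrict R K 1 A α, (restrict_coboundary R K 1 A α).symm⟩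

/-- The projective limit of the groups of exact 2-cochains is the group of closed 2-cochains. -/
lemma mem_limitExact_iff_isClosedCochain [NeZero d] {R : Type*} [CommRing R] [Module R A]
    {c : Cochain (lattice d) 2 A} : c ∈ limitExact d R A ↔ IsClosedCochain c :=
  ⟨isClosedCochain_of_mem_limitExact, fun hc => by
    rw [← coboundary_axialPotential R hc]; exact coboundary_mem_limitExact R _⟩

end Poincare

/-! ### Fourier analysis on compact abelian groups -/

lemma coe_char_inv_apply {G : Type*} [AddCommGroup G] (χ : AddChar G Circle) (x : G) :
    (χ⁻¹ x : ℂ) = (starRingEnd ℂ) (χ x : ℂ) := by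
  rw [AddChar.inv_apply, AddChar.map_neg_eq_inv, Circle.coe_inv_eq_conj]

lemma continuous_integral_continuousMap {G : Type*} [TopologicalSpace G] [CompactSpace G]
    [MeasurableSpace G] [BorelSpace G] (μ : Measure G) [IsFiniteMeasure μ] :
    Continuous fun f : C(G, ℂ) => ∫ x, f x ∂μ := by
  rw [Metric.continuous_iff]
  intro f ε hε
  have hc : 0 < μ.real Set.univ + 1 := by positivity
  refine ⟨ε / (μ.real Set.univ + 1), by positivity, fun g hg => ?_⟩
  have hint : ∀ h : C(G, ℂ), Integrable h μ := fun h =>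
    h.continuous.integrable_of_hasCompactSupport (HasCompactSupport.of_compactSpace h)
  rw [dist_eq_norm, ← integral_sub (hint g) (hint f)]
  refine (norm_integral_le_of_norm_le_const (C := dist g f) (ae_of_all _ fun x => ?_)).trans_lt ?_
  · rw [← dist_eq_norm]
    exact ContinuousMap.dist_apply_le_dist x
  · rw [lt_div_iff₀ hc] at hg
    refine lt_of_le_of_lt ?_ hg
    exact mul_le_mul_of_nonneg_left (by linarith) dist_nonneg

section Fourier

variable {G : Type*} [AddCommGroup G] [TopologicalSpace G]

/-- A continuous character as a continuous complex-valued function. -/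
def charFn (χ : Character G) : C(G, ℂ) :=
  ⟨fun x => (χ.1 x : ℂ), continuous_subtype_val.comp χ.2⟩

/-- Stone–Weierstrass: a group of continuous characters which separates points spans a dense
subspace of the continuous functions. -/
lemma span_charFn_topologicalClosure [CompactSpace G] (S : Subgroup (AddChar G Circle))
    (hcont : ∀ χ ∈ S, Continuous χ) (hsep : ∀ x y : G, x ≠ y → ∃ χ ∈ S, χ x ≠ χ y) :
    (Submodule.span ℂ (charFn '' {χ : Character G | χ.1 ∈ S})).topologicalClosure = ⊤ := by
  let X : Set C(G, ℂ) := charFn '' {χ : Character G | χ.1 ∈ S}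
  let B : StarSubalgebra ℂ C(G, ℂ) :=
  { toSubalgebra := Algebra.adjoin ℂ X
    star_mem' := by
      change Algebra.adjoin ℂ X ≤ star (Algebra.adjoin ℂ X)
      refine Algebra.adjoin_le ?_
      rintro _ ⟨χ, hχ, rfl⟩
      refine Algebra.subset_adjoin ⟨⟨χ.1⁻¹, hcont _ (S.inv_mem hχ)⟩, S.inv_mem hχ, ?_⟩
      ext x
      exact coe_char_inv_apply χ.1 x }
  have hB : B.toSubalgebra.toSubmodule = Submodule.span ℂ X := by
    apply Algebra.adjoin_eq_span_of_subset
    refine Set.Subset.trans (fun f hf => ?_) Submodule.subset_span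
    induction hf using Submonoid.closure_induction with
    | mem f hf => exact hf
    | one =>
      refine ⟨⟨1, hcont _ S.one_mem⟩, S.one_mem, ?_⟩
      ext x
      simp [charFn]
    | mul f g _ _ hf hg =>
      obtain ⟨χ, hχ, rfl⟩ := hf
      obtain ⟨ψ, hψ, rfl⟩ := hg
      refine ⟨⟨χ.1 * ψ.1, hcont _ (S.mul_mem hχ hψ)⟩, S.mul_mem hχ hψ, ?_⟩
      ext x
      simp [charFn]
  have hBsep : B.SeparatesPoints := by
    intro x y hxy
    obtain ⟨χ, hχ, h⟩ := hsep x y hxy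
    refine ⟨_, ⟨charFn ⟨χ, hcont χ hχ⟩, Algebra.subset_adjoin ⟨_, hχ, rfl⟩, rfl⟩, ?_⟩
    exact fun h' => h (Subtype.ext h')
  have := ContinuousMap.starSubalgebra_topologicalClosure_eq_top_of_separatesPoints B hBsep
  change (Submodule.span ℂ X).topologicalClosure = ⊤
  rw [← hB]
  exact congrArg (fun B : StarSubalgebra ℂ C(G, ℂ) => Subalgebra.toSubmodule B.toSubalgebra) this

variable [CompactSpace G] [MeasurableSpace G] [BorelSpace G]

/-- On a compact abelian group, a group of continuous characters which separates points contains
every continuous character: a character outside it would be orthogonal to a dense subspace. -/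
lemma mem_of_separatesPoints [IsTopologicalAddGroup G] (S : Subgroup (AddChar G Circle))
    (hcont : ∀ χ ∈ S, Continuous χ) (hsep : ∀ x y : G, x ≠ y → ∃ χ ∈ S, χ x ≠ χ y)
    (ψ : AddChar G Circle) (hψ : Continuous ψ) : ψ ∈ S := by
  let μ : Measure G := Measure.addHaar
  by_contra hS
  have horth : ∀ χ ∈ S, ∫ x, (χ x : ℂ) * (starRingEnd ℂ) (ψ x : ℂ) ∂μ = 0 := by
    intro χ hχ
    have hne : χ * ψ⁻¹ ≠ 1 := by
      intro h
      rw [mul_inv_eq_one] at h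
      exact hS (h ▸ hχ)
    obtain ⟨g, hg⟩ := DFunLike.ne_iff.1 hne
    have heq : ∀ x, (χ x : ℂ) * (starRingEnd ℂ) (ψ x : ℂ) = ((χ * ψ⁻¹) x : ℂ) := by
      intro x
      rw [AddChar.mul_apply, Circle.coe_mul, coe_char_inv_apply]
    simp only [heq]
    have h1 := integral_add_left_eq_self (μ := μ) (fun x => ((χ * ψ⁻¹) x : ℂ)) g
    simp only [AddChar.map_add_eq_mul, Circle.coe_mul, integral_const_mul] at h1
    have h2 : (((χ * ψ⁻¹) g : ℂ) - 1) * ∫ x, ((χ * ψ⁻¹) x : ℂ) ∂μ = 0 := by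
      rw [sub_mul, h1, one_mul, sub_self]
    refine (mul_eq_zero.1 h2).resolve_left fun h => hg ?_
    exact Subtype.ext (by simpa [sub_eq_zero] using h)
  have hdense := span_charFn_topologicalClosure S hcont hsep
  let ψ' : C(G, ℂ) := star (charFn ⟨ψ, hψ⟩)
  have hzero : ∀ f : C(G, ℂ), ∫ x, (f * ψ') x ∂μ = 0 := by
    have hcl : IsClosed {f : C(G, ℂ) | ∫ x, (f * ψ') x ∂μ = 0} :=
      isClosed_eq ((continuous_integral_continuousMap μ).comp (continuous_mul_const ψ'))
        continuous_const
    have hint : ∀ h : C(G, ℂ), Integrable h μ := fun h =>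
      h.continuous.integrable_of_hasCompactSupport (HasCompactSupport.of_compactSpace h)
    have hsub : (Submodule.span ℂ (charFn '' {χ : Character G | χ.1 ∈ S}) : Set C(G, ℂ)) ⊆
        {f : C(G, ℂ) | ∫ x, (f * ψ') x ∂μ = 0} := by
      intro f hf
      induction hf using Submodule.span_induction with
      | mem f hf =>
        obtain ⟨χ, hχ, rfl⟩ := hf
        exact horth _ hχ
      | zero => simp
      | add f g _ _ hf hg =>
        simp only [Set.mem_ofPred_eq] at *
        rw [add_mul, ← add_zero (0 : ℂ)]
        nth_rw 1 [← hf]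
        rw [← hg]
        exact integral_add (hint _) (hint _)
      | smul a f _ hf =>
        simp only [Set.mem_ofPred_eq] at *
        rw [smul_mul_assoc]
        simp only [ContinuousMap.coe_smul, Pi.smul_apply]
        rw [integral_smul, hf, smul_zero]
    intro f
    have hf : f ∈ (Submodule.span ℂ (charFn '' {χ : Character G | χ.1 ∈ S})).topologicalClosure := by
      rw [hdense]; trivial
    exact closure_minimal hsub hcl hf
  have h1 := hzero (charFn ⟨ψ, hψ⟩)
  have h2 : ∀ x, (charFn ⟨ψ, hψ⟩ * ψ') x = 1 := by
    intro x
    simp only [ψ', charFn, ContinuousMap.mul_apply, ContinuousMap.coe_mk, ContinuousMap.star_apply,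
      RCLike.star_def, Complex.mul_conj, Complex.normSq_eq_norm_sq, Circle.norm_coe]
    norm_num
  simp only [h2, integral_const] at h1
  have h3 : μ.real Set.univ = 0 := by simpa using h1
  rw [measureReal_eq_zero_iff] at h3
  exact (isOpen_univ.measure_pos μ Set.univ_nonempty).ne' h3

/-- Two probability measures integrate all continuous functions alike as soon as they integrate
alike the members of a separating group of characters. -/
lemma integral_eq_of_integral_char_eq (S : Subgroup (AddChar G Circle))
    (hcont : ∀ χ ∈ S, Continuous χ) (hsep : ∀ x y : G, x ≠ y → ∃ χ ∈ S, χ x ≠ χ y)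
    (μ ν : Measure G) [IsProbabilityMeasure μ] [IsProbabilityMeasure ν]
    (h : ∀ χ ∈ S, ∫ x, (χ x : ℂ) ∂μ = ∫ x, (χ x : ℂ) ∂ν) (f : C(G, ℂ)) :
    ∫ x, f x ∂μ = ∫ x, f x ∂ν := by
  have hcl : IsClosed {f : C(G, ℂ) | ∫ x, f x ∂μ = ∫ x, f x ∂ν} :=
    isClosed_eq (continuous_integral_continuousMap μ) (continuous_integral_continuousMap ν)
  have hint : ∀ (ρ : Measure G) [IsFiniteMeasure ρ] (h : C(G, ℂ)), Integrable h ρ := fun ρ _ h =>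
    h.continuous.integrable_of_hasCompactSupport (HasCompactSupport.of_compactSpace h)
  have hsub : (Submodule.span ℂ (charFn '' {χ : Character G | χ.1 ∈ S}) : Set C(G, ℂ)) ⊆
      {f : C(G, ℂ) | ∫ x, f x ∂μ = ∫ x, f x ∂ν} := by
    intro f hf
    induction hf using Submodule.span_induction with
    | mem f hf =>
      obtain ⟨χ, hχ, rfl⟩ := hf
      exact h _ hχ
    | zero => simp
    | add f g _ _ hf hg =>
      simp only [Set.mem_ofPred_eq, ContinuousMap.coe_add, Pi.add_apply] at *
      rw [integral_add (hint _ _) (hint _ _), integral_add (hint _ _) (hint _ _), hf, hg]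
    | smul a f _ hf =>
      simp only [Set.mem_ofPred_eq, ContinuousMap.coe_smul, Pi.smul_apply] at *
      rw [integral_smul, integral_smul, hf]
  have hf : f ∈ (Submodule.span ℂ (charFn '' {χ : Character G | χ.1 ∈ S})).topologicalClosure := by
    rw [span_charFn_topologicalClosure S hcont hsep]; trivial
  exact closure_minimal hsub hcl hf

/-- Fourier uniqueness. -/
lemma ext_of_integral_char_eq [HasOuterApproxClosed G] (S : Subgroup (AddChar G Circle))
    (hcont : ∀ χ ∈ S, Continuous χ) (hsep : ∀ x y : G, x ≠ y → ∃ χ ∈ S, χ x ≠ χ y)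
    (μ ν : Measure G) [IsProbabilityMeasure μ] [IsProbabilityMeasure ν]
    (h : ∀ χ ∈ S, ∫ x, (χ x : ℂ) ∂μ = ∫ x, (χ x : ℂ) ∂ν) : μ = ν := by
  refine ext_of_forall_integral_eq_of_IsFiniteMeasure fun f => ?_
  have := integral_eq_of_integral_char_eq S hcont hsep μ ν h
    ⟨fun x => (f x : ℂ), Complex.continuous_ofReal.comp f.continuous⟩
  simp only [ContinuousMap.coe_mk, integral_complex_ofReal] at this
  exact_mod_cast this

/-- A family of probability measures whose Fourier coefficients converge has a limit: by compactness
of the space of probability measures. -/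
lemma exists_measure_of_tendsto_integral_char [T2Space G] [HasOuterApproxClosed G] {ι : Type*}
    {l : Filter ι} [l.NeBot] (P : ι → Measure G) (hP : ∀ i, IsProbabilityMeasure (P i))
    (φ : Character G → ℂ)
    (h : ∀ χ : Character G, Tendsto (fun i => ∫ x, (χ.1 x : ℂ) ∂(P i)) l (𝓝 (φ χ))) :
    ∃ ν : Measure G, IsProbabilityMeasure ν ∧ ∀ χ : Character G, ∫ x, (χ.1 x : ℂ) ∂ν = φ χ := by
  let Q : ι → ProbabilityMeasure G := fun i => ⟨P i, hP i⟩
  let U : Ultrafilter ι := Ultrafilter.of l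
  obtain ⟨ν, -, hν⟩ := isCompact_univ.ultrafilter_le_nhds (U.map Q) (by simp)
  have hν' : Tendsto Q U (𝓝 ν) := hν
  rw [ProbabilityMeasure.tendsto_iff_forall_integral_rclike_tendsto ℂ] at hν'
  refine ⟨ν, inferInstance, fun χ => ?_⟩
  have h1 := hν' (BoundedContinuousFunction.mkOfCompact (charFn χ))
  exact tendsto_nhds_unique h1 ((h χ).mono_left (Ultrafilter.of_le l))

end Fourier

/-! ### The group `Im d_{ℤ^d,1}^G` and the Hilbert space `Im d_{ℤ^d,1}^𝔤` -/

instance : Countable (Cell d) :=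
  Function.Injective.countable (f := fun σ : Cell d => (σ.base, σ.dirs))
    (fun _ _ h => Cell.ext (congrArg Prod.fst h) (congrArg Prod.snd h))

lemma continuous_comp {A : Type*} [AddCommGroup A] [TopologicalSpace A] [ContinuousNeg A]
    (a b : Fin d) (v : Fin d → ℤ) : Continuous fun c : Cochain (lattice d) 2 A => comp c a b v := by
  unfold comp
  split_ifs
  · exact continuous_apply _
  · exact (continuous_apply _).neg
  · exact continuous_const

lemma isClosed_setOf_isClosedCochain (A : Type*) [AddCommGroup A] [TopologicalSpace A]
    [IsTopologicalAddGroup A] [T1Space A] :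
    IsClosed {c : Cochain (lattice d) 2 A | IsClosedCochain c} := by
  simp only [IsClosedCochain, Set.ofPred_forall]
  refine isClosed_iInter fun a => isClosed_iInter fun b => isClosed_iInter fun e =>
    isClosed_iInter fun v => ?_
  refine isClosed_singleton.preimage (f := fun c : Cochain (lattice d) 2 A =>
    (comp c a b (v + Pi.single e 1) - comp c a b v) +
    (comp c b e (v + Pi.single a 1) - comp c b e v) +
    (comp c e a (v + Pi.single b 1) - comp c e a v)) ?_
  exact (((continuous_comp _ _ _).sub (continuous_comp _ _ _)).add
    ((continuous_comp _ _ _).sub (continuous_comp _ _ _))).add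
    ((continuous_comp _ _ _).sub (continuous_comp _ _ _))

section Exact

variable [NeZero d]

instance : CompactSpace (ExactG d) := by
  have h : IsClosed (limitExact d ℤ U1 : Set (Cochain (lattice d) 2 U1)) := by
    convert isClosed_setOf_isClosedCochain (d := d) U1 using 1
    ext c
    exact mem_limitExact_iff_isClosedCochain
  exact isCompact_iff_compactSpace.1 h.isCompact

instance : HasOuterApproxClosed (ExactG d) := by
  have : SecondCountableTopology (ExactG d) :=
    TopologicalSpace.Subtype.secondCountableTopology _
  have := TopologicalSpace.metrizableSpace_of_t3_secondCountable (ExactG d)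
  let := TopologicalSpace.pseudoMetrizableSpacePseudoMetric (ExactG d)
  infer_instance

instance : CompleteSpace (exactL2 d) := by
  have h : IsClosed (exactL2 d : Set (lp (fun _ : (lattice d).Face 2 => ℝ) 2)) := by
    have : (exactL2 d : Set (lp (fun _ : (lattice d).Face 2 => ℝ) 2)) =
        (fun x : lp (fun _ : (lattice d).Face 2 => ℝ) 2 => (⇑x : Cochain (lattice d) 2 ℝ)) ⁻¹'
          {c | IsClosedCochain c} := by
      ext x
      exact mem_limitExact_iff_isClosedCochain
    rw [this]
    refine (isClosed_setOf_isClosedCochain ℝ).preimage ?_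
    exact continuous_pi fun p => (lp.evalCLM ℝ (fun _ : (lattice d).Face 2 => ℝ) 2 p).continuous
  exact h.completeSpace_coe

/-- The character `c ↦ e^{2πi c(p)}`. -/
def evalChar (p : Plaquette d) : AddChar (ExactG d) Circle where
  toFun := fun c => AddCircle.toCircle (c.1 p)
  map_zero_eq_one' := AddCircle.toCircle_zero
  map_add_eq_mul' _ _ := AddCircle.toCircle_add _ _

lemma continuous_evalChar (p : Plaquette d) : Continuous (evalChar p) :=
  AddCircle.continuous_toCircle.comp ((continuous_apply p).comp continuous_subtype_val)

/-- The group of characters generated by the plaquette characters. -/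
def plaquetteChars (d : ℕ) [NeZero d] : Subgroup (AddChar (ExactG d) Circle) :=
  Subgroup.closure (Set.range evalChar)

lemma continuous_of_mem_plaquetteChars (χ : AddChar (ExactG d) Circle) (hχ : χ ∈ plaquetteChars d) :
    Continuous χ := by
  induction hχ using Subgroup.closure_induction with
  | mem χ h =>
    obtain ⟨p, rfl⟩ := h
    exact continuous_evalChar p
  | one => exact continuous_const
  | mul χ ψ _ _ h1 h2 => exact h1.mul h2
  | inv χ _ h =>
    have : ⇑(χ⁻¹) = fun x => (χ x)⁻¹ := by
      funext x
      rw [AddChar.inv_apply, AddChar.map_neg_eq_inv]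
    rw [this]
    exact h.inv

lemma exists_mem_plaquetteChars_ne (x y : ExactG d) (h : x ≠ y) :
    ∃ χ ∈ plaquetteChars d, χ x ≠ χ y := by
  obtain ⟨p, hp⟩ := Function.ne_iff.1 fun h' => h (Subtype.ext h')
  exact ⟨evalChar p, Subgroup.subset_closure ⟨p, rfl⟩,
    fun h' => hp (AddCircle.injective_toCircle one_ne_zero h')⟩

lemma mem_plaquetteChars (χ : Character (ExactG d)) : χ.1 ∈ plaquetteChars d :=
  mem_of_separatesPoints _ continuous_of_mem_plaquetteChars exists_mem_plaquetteChars_ne _ χ.2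

/-- The functional `x ↦ x(p)`. -/
def coordL2 (p : Plaquette d) : exactL2 d →L[ℝ] ℝ :=
  (lp.evalCLM ℝ (fun _ : (lattice d).Face 2 => ℝ) 2 p).comp (exactL2 d).subtypeL

lemma evalChar_expMap (p : Plaquette d) (x : exactL2 d) :
    evalChar p (expMap x) = Circle.exp (2 * Real.pi * coordL2 p x) := by
  change AddCircle.toCircle ((x.1 p : ℝ) : U1) = _
  rw [AddCircle.toCircle_apply_mk, div_one]
  rfl

lemma exists_differential (χ : AddChar (ExactG d) Circle) (hχ : χ ∈ plaquetteChars d) :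
    ∃ ξ : exactL2 d →L[ℝ] ℝ, ∀ x, χ (expMap x) = Circle.exp (2 * Real.pi * ξ x) := by
  induction hχ using Subgroup.closure_induction with
  | mem χ h =>
    obtain ⟨p, rfl⟩ := h
    exact ⟨coordL2 p, evalChar_expMap p⟩
  | one => exact ⟨0, fun x => by simp⟩
  | mul χ ψ _ _ h1 h2 =>
    obtain ⟨ξ, hξ⟩ := h1
    obtain ⟨η, hη⟩ := h2
    refine ⟨ξ + η, fun x => ?_⟩
    rw [AddChar.mul_apply, hξ, hη, ← Circle.exp_add, add_apply, mul_add]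
  | inv χ _ h =>
    obtain ⟨ξ, hξ⟩ := h
    refine ⟨-ξ, fun x => ?_⟩
    rw [AddChar.inv_apply, AddChar.map_neg_eq_inv, hξ, ← Circle.exp_neg,
      neg_apply, mul_neg]

lemma char_expMap (χ : Character (ExactG d)) (x : exactL2 d) :
    χ.1 (expMap x) = Circle.exp (2 * Real.pi * charDifferential χ x) :=
  Classical.epsilon_spec (p := fun ξ : exactL2 d →L[ℝ] ℝ =>
    ∀ x, χ.1 (expMap x) = Circle.exp (2 * Real.pi * ξ x))
    (exists_differential _ (mem_plaquetteChars χ)) x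

/-- The differential of a character is determined by `χ (exp x) = e^{2πi ξ(x)}`: a linear functional
with integral values vanishes. -/
lemma charDifferential_eq (χ : Character (ExactG d)) (ξ : exactL2 d →L[ℝ] ℝ)
    (h : ∀ x, χ.1 (expMap x) = Circle.exp (2 * Real.pi * ξ x)) : charDifferential χ = ξ := by
  ext x
  by_contra hne
  have hne' : charDifferential χ x - ξ x ≠ 0 := sub_ne_zero.2 hne
  have key : ∀ t : ℝ, ∃ m : ℤ, t * (charDifferential χ x - ξ x) = m := by
    intro t
    have h1 := (char_expMap χ (t • x)).symm.trans (h (t • x))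
    rw [Circle.exp_eq_exp] at h1
    obtain ⟨m, hm⟩ := h1
    refine ⟨m, ?_⟩
    simp only [map_smul, smul_eq_mul] at hm
    have hpi : (2 * Real.pi) ≠ 0 := by positivity
    apply mul_left_cancel₀ hpi
    linarith
  obtain ⟨m, hm⟩ := key (1 / (2 * (charDifferential χ x - ξ x)))
  have : (2 * m : ℝ) = 1 := by
    rw [← hm]
    field_simp
  have h2 : 2 * m = 1 := by exact_mod_cast this
  omega

/-! ### Existence and uniqueness of the heat kernel measure -/

lemma isHeatKernelMeasure_iff (β : ℝ) (ν : Measure (ExactG d)) :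
    IsHeatKernelMeasure charDifferential β ν ↔ IsProbabilityMeasure ν ∧
      ∀ χ : Character (ExactG d), ∫ x, (χ.1 x : ℂ) ∂ν =
        (Real.exp (-4 * Real.pi ^ 2 * β * ‖charDifferential χ‖ ^ 2) : ℝ) := by
  refine and_congr_right fun _ => forall_congr' fun χ => ?_
  rw [integral_conj]
  nth_rw 1 [← Complex.conj_ofReal]
  exact (starRingEnd ℂ).injective.eq_iff

lemma IsHeatKernelMeasure.unique {β : ℝ} {μ ν : Measure (ExactG d)}
    (hμ : IsHeatKernelMeasure charDifferential β μ)
    (hν : IsHeatKernelMeasure charDifferential β ν) : μ = ν := by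
  rw [isHeatKernelMeasure_iff] at hμ hν
  obtain ⟨_, h1⟩ := hμ
  obtain ⟨_, h2⟩ := hν
  refine ext_of_integral_char_eq _ continuous_of_mem_plaquetteChars exists_mem_plaquetteChars_ne
    μ ν fun χ hχ => ?_
  have hc := continuous_of_mem_plaquetteChars χ hχ
  exact (h1 ⟨χ, hc⟩).trans (h2 ⟨χ, hc⟩).symm

/-- The law of `exp (∑ t_i b_i)` for independent centred Gaussian variables `t_i` of variance `v`. -/
def expGaussian {ι : Type*} [Fintype ι] (v : NNReal) (b : ι → exactL2 d) : Measure (ExactG d) :=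
  (Measure.pi fun _ : ι => ProbabilityTheory.gaussianReal 0 v).map fun t => expMap (∑ i, t i • b i)

lemma continuous_expMap_sum {ι : Type*} [Fintype ι] (b : ι → exactL2 d) :
    Continuous fun t : ι → ℝ => expMap (∑ i, t i • b i) := by
  refine Continuous.subtype_mk (continuous_pi fun p => ?_) _
  have h1 : Continuous fun t : ι → ℝ => coordL2 p (∑ i, t i • b i) := by fun_prop
  exact (AddCircle.continuous_mk' 1).comp h1

instance {ι : Type*} [Fintype ι] (v : NNReal) (b : ι → exactL2 d) :
    IsProbabilityMeasure (expGaussian v b) :=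
  Measure.isProbabilityMeasure_map (continuous_expMap_sum b).measurable.aemeasurable

lemma integral_char_expGaussian {ι : Type*} [Fintype ι] (v : NNReal) (b : ι → exactL2 d)
    (χ : Character (ExactG d)) :
    ∫ x, (χ.1 x : ℂ) ∂(expGaussian v b) =
      (Real.exp (-2 * Real.pi ^ 2 * v * ∑ i, charDifferential χ (b i) ^ 2) : ℝ) := by
  have hχ : Continuous fun x => (χ.1 x : ℂ) := continuous_subtype_val.comp χ.2
  rw [expGaussian, integral_map (continuous_expMap_sum b).measurable.aemeasurable
    hχ.aestronglyMeasurable]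
  have h1 : ∀ t : ι → ℝ, (χ.1 (expMap (∑ i, t i • b i)) : ℂ) =
      ∏ i, Complex.exp (((2 * Real.pi * charDifferential χ (b i) : ℝ) : ℂ) * (t i : ℂ) *
        Complex.I) := by
    intro t
    rw [char_expMap, Circle.coe_exp, ← Complex.exp_sum]
    congr 1
    simp only [map_sum, map_smul, smul_eq_mul]
    push_cast
    rw [Finset.mul_sum, Finset.sum_mul]
    exact Finset.sum_congr rfl fun i _ => by ring
  simp only [h1]
  rw [integral_fintype_prod_eq_prod (𝕜 := ℂ) (fun i (t : ℝ) =>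
    Complex.exp (((2 * Real.pi * charDifferential χ (b i) : ℝ) : ℂ) * (t : ℂ) * Complex.I))]
  have h2 : ∀ i, ∫ t : ℝ, Complex.exp (((2 * Real.pi * charDifferential χ (b i) : ℝ) : ℂ) *
      (t : ℂ) * Complex.I) ∂(ProbabilityTheory.gaussianReal 0 v) =
      Complex.exp ((-2 * Real.pi ^ 2 * v * charDifferential χ (b i) ^ 2 : ℝ) : ℂ) := by
    intro i
    rw [← charFun_apply_real, ProbabilityTheory.charFun_gaussianReal]
    congr 1
    push_cast
    ring
  simp only [h2]
  rw [← Complex.exp_sum, Complex.ofReal_exp]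
  congr 1
  push_cast
  rw [Finset.mul_sum]

theorem exists_isHeatKernelMeasure {β : ℝ} (hβ : 0 ≤ β) :
    ∃ ν : Measure (ExactG d), IsHeatKernelMeasure charDifferential β ν := by
  obtain ⟨w, b, -⟩ := exists_hilbertBasis ℝ (exactL2 d)
  let P : Finset w → Measure (ExactG d) := fun s =>
    expGaussian (2 * β).toNNReal fun i : {i // i ∈ s} => b i.1
  have hP : ∀ s, IsProbabilityMeasure (P s) := fun s => by unfold P; infer_instance
  have hlim : ∀ χ : Character (ExactG d), Tendsto (fun s => ∫ x, (χ.1 x : ℂ) ∂(P s)) atTop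
      (𝓝 ((Real.exp (-4 * Real.pi ^ 2 * β * ‖charDifferential χ‖ ^ 2) : ℝ) : ℂ)) := by
    intro χ
    let r := (InnerProductSpace.toDual ℝ (exactL2 d)).symm (charDifferential χ)
    have hr : ∀ x, inner ℝ r x = charDifferential χ x := fun x =>
      InnerProductSpace.toDual_symm_apply
    have hsum : HasSum (fun i => charDifferential χ (b i) ^ 2) (‖charDifferential χ‖ ^ 2) := by
      have := b.hasSum_inner_mul_inner r r
      rw [real_inner_self_eq_norm_sq, LinearIsometryEquiv.norm_map] at this
      have heq : (fun i => inner ℝ r (b i) * inner ℝ (b i) r) =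
          fun i => charDifferential χ (b i) ^ 2 := by
        funext i
        rw [real_inner_comm r (b i), hr, sq]
      rwa [heq] at this
    have h1 : ∀ s, ∫ x, (χ.1 x : ℂ) ∂(P s) =
        ((Real.exp (-4 * Real.pi ^ 2 * β * ∑ i ∈ s, charDifferential χ (b i) ^ 2) : ℝ) : ℂ) := by
      intro s
      simp only [P]
      rw [integral_char_expGaussian, ← Finset.sum_coe_sort s]
      congr 2
      rw [Real.coe_toNNReal _ (by positivity)]
      ring
    simp only [h1]
    refine (Complex.continuous_ofReal.tendsto _).comp ((Real.continuous_exp.tendsto _).comp ?_)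
    exact hsum.const_mul _
  obtain ⟨ν, h1, h2⟩ := exists_measure_of_tendsto_integral_char P hP _ hlim
  exact ⟨ν, (isHeatKernelMeasure_iff β ν).2 ⟨h1, h2⟩⟩

lemma isHeatKernelMeasure_heatKernelMeasure {β : ℝ} (hβ : 0 ≤ β) :
    IsHeatKernelMeasure charDifferential β (heatKernelMeasure d β) :=
  Classical.epsilon_spec (exists_isHeatKernelMeasure hβ)

end Exact

/-! ### The measure on gauge classes -/

section GaugeClasses

lemma curvatureBar_injective [NeZero d] : Function.Injective (curvatureBar d) := by
  rw [injective_iff_map_eq_zero]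
  intro x hx
  obtain ⟨α, rfl⟩ := QuotientAddGroup.mk_surjective x
  have h : coboundary ℤ (lattice d) 1 U1 α = 0 := congrArg Subtype.val hx
  obtain ⟨φ, hφ⟩ := exists_coboundary_eq_of_coboundary_eq_zero ℤ h
  exact (QuotientAddGroup.eq_zero_iff α).2 ⟨φ, hφ⟩

lemma curvatureBar_axialPotential [NeZero d] (c : ExactG d) :
    curvatureBar d (QuotientAddGroup.mk (axialPotential c.1)) = c :=
  Subtype.ext (coboundary_axialPotential ℤ (mem_limitExact_iff_isClosedCochain.1 c.2))

lemma curvatureBar_invFun [NeZero d] (c : ExactG d) :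
    curvatureBar d (Function.invFun (curvatureBar d) c) = c :=
  Function.invFun_eq ⟨_, curvatureBar_axialPotential c⟩

lemma invFun_curvatureBar [NeZero d] : Function.invFun (curvatureBar d) =
    fun c => QuotientAddGroup.mk (axialPotential c.1) := by
  funext c
  apply curvatureBar_injective
  rw [curvatureBar_invFun, curvatureBar_axialPotential]

lemma continuous_axialPotential :
    Continuous (axialPotential : Cochain (lattice d) 2 U1 → Cochain (lattice d) 1 U1) := by
  refine continuous_pi fun σ => ?_
  unfold axialPotential
  refine continuous_finsetSum _ fun j _ => ?_
  split_ifs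
  · unfold segInt antidiff
    exact (continuous_finsetSum _ fun t _ => continuous_comp _ _ _).sub
      (continuous_finsetSum _ fun t _ => continuous_comp _ _ _)
  · exact continuous_const

lemma measurable_invFun_curvatureBar [NeZero d] :
    Measurable (Function.invFun (curvatureBar d)) := by
  rw [invFun_curvatureBar]
  exact QuotientAddGroup.measurable_coe.comp
    (continuous_axialPotential.measurable.comp measurable_subtype_coe)

lemma measurable_curvatureBar [NeZero d] : Measurable (curvatureBar d) := by
  refine QuotientAddGroup.measurable_from_quotient.2 ?_
  refine Measurable.subtype_mk (measurable_pi_lambda _ fun σ => ?_)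
  simp only [coboundary, LinearMap.coe_mk, AddHom.coe_mk]
  refine Finset.measurable_fun_sum _ fun i _ => ?_
  exact (continuous_zsmul _).measurable.comp
    ((measurable_pi_apply (Subcomplex.Face.front (k := 1) σ i.1 i.2)).sub
      (measurable_pi_apply (Subcomplex.Face.back (k := 1) σ i.1 i.2)))

/-- Integrals over gauge classes of functions of the curvature. -/
lemma integral_latticeMeasure [NeZero d] (β : ℝ) {f : ExactG d → ℂ} (hf : Continuous f) :
    ∫ x, f (curvatureBar d x) ∂(latticeMeasure d β) = ∫ c, f c ∂(heatKernelMeasure d β) := by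
  have h := integral_map (μ := heatKernelMeasure d β) (f := fun x => f (curvatureBar d x))
    measurable_invFun_curvatureBar.aemeasurable
    (hf.measurable.comp measurable_curvatureBar).aestronglyMeasurable
  simp only [curvatureBar_invFun] at h
  exact h

end GaugeClasses

/-! ### Translations -/

section Translation

variable {A : Type*}

/-- Translation of 2-cochains with arbitrary coefficients. -/
def shiftCochain (a : Fin d → ℤ) (c : Cochain (lattice d) 2 A) : Cochain (lattice d) 2 A :=
  fun σ => c (Plaquette.shift (-a) σ)

lemma comp_shiftCochain [AddCommGroup A] (a : Fin d → ℤ) (c : Cochain (lattice d) 2 A)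
    (i j : Fin d) (v : Fin d → ℤ) : comp (shiftCochain a c) i j v = comp c i j (v + -a) := rfl

lemma IsClosedCochain.shiftCochain [AddCommGroup A] {c : Cochain (lattice d) 2 A}
    (hc : IsClosedCochain c) (a : Fin d → ℤ) : IsClosedCochain (shiftCochain a c) := by
  intro i j k v
  have := hc i j k (v + -a)
  simp only [comp_shiftCochain, add_right_comm v _ (-a)]
  exact this

lemma plaquette_shift_shift_neg (a : Fin d → ℤ) (p : Plaquette d) :
    Plaquette.shift (-a) (Plaquette.shift a p) = p :=
  Subtype.ext (Cell.ext (add_neg_cancel_right _ _) rfl)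

lemma plaquette_shift_neg_shift (a : Fin d → ℤ) (p : Plaquette d) :
    Plaquette.shift a (Plaquette.shift (-a) p) = p :=
  Subtype.ext (Cell.ext (neg_add_cancel_right _ _) rfl)

/-- Translation of plaquettes as a permutation. -/
def shiftEquiv (a : Fin d → ℤ) : Plaquette d ≃ Plaquette d where
  toFun := Plaquette.shift a
  invFun := Plaquette.shift (-a)
  left_inv := plaquette_shift_shift_neg a
  right_inv := plaquette_shift_neg_shift a

lemma memℓp_two_iff {ι : Type*} (f : ι → ℝ) : Memℓp f 2 ↔ Summable fun i => f i ^ 2 := by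
  rw [memℓp_gen_iff (by simp)]
  simp

variable [NeZero d]

/-- Translation on `Im d_{ℤ^d,1}^G`. -/
def translateExactG (a : Fin d → ℤ) (c : ExactG d) : ExactG d :=
  ⟨shiftCochain a c.1, mem_limitExact_iff_isClosedCochain.2
    ((mem_limitExact_iff_isClosedCochain.1 c.2).shiftCochain a)⟩

lemma continuous_translateExactG (a : Fin d → ℤ) :
    Continuous (translateExactG a : ExactG d → ExactG d) := by
  have h : Continuous fun c : ExactG d => shiftCochain a c.1 := continuous_pi fun p =>
    (continuous_apply (Plaquette.shift (-a) p)).comp continuous_subtype_val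
  exact h.subtype_mk _

/-- Translation on `Im d_{ℤ^d,1}^𝔤`. -/
def translateL2 (a : Fin d → ℤ) : exactL2 d →ₗ[ℝ] exactL2 d where
  toFun x := ⟨⟨shiftCochain a (x.1 : Cochain (lattice d) 2 ℝ), (memℓp_two_iff _).2
    (((memℓp_two_iff _).1 x.1.2).comp_injective (shiftEquiv (-a)).injective)⟩,
    mem_limitExact_iff_isClosedCochain.2
      ((mem_limitExact_iff_isClosedCochain.1 x.2).shiftCochain a)⟩
  map_add' _ _ := rfl
  map_smul' _ _ := rfl

lemma norm_translateL2 (a : Fin d → ℤ) (x : exactL2 d) : ‖translateL2 a x‖ = ‖x‖ := by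
  change ‖(translateL2 a x).1‖ = ‖x.1‖
  rw [lp.norm_eq_tsum_rpow (by simp), lp.norm_eq_tsum_rpow (by simp)]
  congr 1
  exact (shiftEquiv (-a)).tsum_eq fun p => ‖x.1 p‖ ^ (2 : ENNReal).toReal

/-- Composition of a character with a translation. -/
def translateChar (a : Fin d → ℤ) (χ : Character (ExactG d)) : Character (ExactG d) :=
  ⟨{ toFun := fun c => χ.1 (translateExactG a c)
     map_zero_eq_one' := χ.1.map_zero_eq_one
     map_add_eq_mul' := fun c c' =>
       χ.1.map_add_eq_mul (translateExactG a c) (translateExactG a c') },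
    χ.2.comp (continuous_translateExactG a)⟩

lemma charDifferential_translateChar (a : Fin d → ℤ) (χ : Character (ExactG d)) :
    charDifferential (translateChar a χ) = (charDifferential χ).comp
      ((translateL2 a).mkContinuous 1 fun x => by rw [norm_translateL2, one_mul]) :=
  charDifferential_eq _ _ fun x => char_expMap χ (translateL2 a x)

lemma norm_charDifferential_translateChar_le (a : Fin d → ℤ) (χ : Character (ExactG d)) :
    ‖charDifferential (translateChar a χ)‖ ≤ ‖charDifferential χ‖ := by
  rw [charDifferential_translateChar]
  refine ContinuousLinearMap.opNorm_le_bound _ (norm_nonneg (charDifferential χ)) fun x => ?_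
  refine ((charDifferential χ).le_opNorm (translateL2 a x)).trans_eq ?_
  rw [norm_translateL2]

lemma norm_charDifferential_translateChar (a : Fin d → ℤ) (χ : Character (ExactG d)) :
    ‖charDifferential (translateChar a χ)‖ = ‖charDifferential χ‖ := by
  refine le_antisymm (norm_charDifferential_translateChar_le a χ) ?_
  have h := norm_charDifferential_translateChar_le (-a) (translateChar a χ)
  have : translateChar (-a) (translateChar a χ) = χ := by
    refine Subtype.ext (DFunLike.ext _ _ fun c => ?_)
    change χ.1 (translateExactG a (translateExactG (-a) c)) = χ.1 c
    congr 1
    refine Subtype.ext (funext fun p => ?_)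
    change c.1 (Plaquette.shift (- -a) (Plaquette.shift (-a) p)) = c.1 p
    rw [neg_neg, plaquette_shift_neg_shift]
  rwa [this] at h

/-- The heat kernel measure is translation invariant: its image under a translation has the same
Fourier transform. -/
lemma map_translateExactG_heatKernelMeasure {β : ℝ} (hβ : 0 ≤ β) (a : Fin d → ℤ) :
    (heatKernelMeasure d β).map (translateExactG a) = heatKernelMeasure d β := by
  have hν := isHeatKernelMeasure_heatKernelMeasure (d := d) hβ
  refine IsHeatKernelMeasure.unique (β := β) ?_ hν
  rw [isHeatKernelMeasure_iff] at hν ⊢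
  obtain ⟨_, h⟩ := hν
  have hm : Measurable (translateExactG a : ExactG d → ExactG d) :=
    (continuous_translateExactG a).measurable
  refine ⟨Measure.isProbabilityMeasure_map hm.aemeasurable, fun χ => ?_⟩
  have hχ : Continuous fun x => (χ.1 x : ℂ) := continuous_subtype_val.comp χ.2
  rw [integral_map hm.aemeasurable hχ.aestronglyMeasurable,
    ← norm_charDifferential_translateChar a χ]
  exact h (translateChar a χ)

lemma curvatureBar_translateGaugeClass (a : Fin d → ℤ) (x : GaugeClass d) :
    curvatureBar d (translateGaugeClass a x) = translateExactG a (curvatureBar d x) := by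
  obtain ⟨α, rfl⟩ := QuotientAddGroup.mk_surjective x
  exact Subtype.ext (translateCochain_coboundary a α).symm

theorem map_translateGaugeClass_latticeMeasure {β : ℝ} (hβ : 0 ≤ β) (a : Fin d → ℤ) :
    (latticeMeasure d β).map (translateGaugeClass a) = latticeMeasure d β := by
  have hm : Measurable (translateGaugeClass a : GaugeClass d → GaugeClass d) := by
    refine QuotientAddGroup.measurable_from_quotient.2 (QuotientAddGroup.measurable_coe.comp
      (g := fun c : Cochain (lattice d) 1 U1 => (c : GaugeClass d)) ?_)
    exact measurable_pi_lambda _ fun _ => measurable_pi_apply _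
  rw [latticeMeasure, Measure.map_map hm measurable_invFun_curvatureBar]
  nth_rw 2 [← map_translateExactG_heatKernelMeasure hβ a]
  rw [Measure.map_map measurable_invFun_curvatureBar (continuous_translateExactG a).measurable]
  congr 1
  funext c
  apply curvatureBar_injective
  simp only [Function.comp_apply, curvatureBar_invFun, curvatureBar_translateGaugeClass]

end Translation

/-! ### The two-point function in terms of the Hilbert space -/

section Correlation

variable [NeZero d]

/-- The vector of `Im d_{ℤ^d,1}^𝔤` representing the functional `x ↦ x(p)`: the orthogonal projection
of the indicator function of `p`. -/
def projDelta (p : Plaquette d) : exactL2 d :=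
  (InnerProductSpace.toDual ℝ (exactL2 d)).symm (coordL2 p)

lemma inner_projDelta (p : Plaquette d) (x : exactL2 d) : inner ℝ (projDelta p) x = x.1 p :=
  InnerProductSpace.toDual_symm_apply

lemma norm_projDelta_le_one (p : Plaquette d) : ‖projDelta p‖ ≤ 1 := by
  rw [projDelta, LinearIsometryEquiv.norm_map]
  refine ContinuousLinearMap.opNorm_le_bound _ zero_le_one fun x => ?_
  rw [one_mul]
  exact lp.norm_apply_le_norm (by simp) x.1 p

lemma integral_char_heatKernelMeasure {β : ℝ} (hβ : 0 ≤ β) (χ : Character (ExactG d))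
    (x : exactL2 d) (hx : ∀ y, χ.1 (expMap y) = Circle.exp (2 * Real.pi * inner ℝ x y)) :
    ∫ c, (χ.1 c : ℂ) ∂(heatKernelMeasure d β) =
      (Real.exp (-4 * Real.pi ^ 2 * β * ‖x‖ ^ 2) : ℝ) := by
  rw [((isHeatKernelMeasure_iff β _).1 (isHeatKernelMeasure_heatKernelMeasure hβ)).2,
    charDifferential_eq χ (InnerProductSpace.toDual ℝ _ x) hx, LinearIsometryEquiv.norm_map]

/-- The connected two-point function of Wilson loops, in terms of `G(p, q) = ⟨P δ_p, P δ_q⟩`. -/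
theorem norm_correlation {β : ℝ} (hβ : 0 ≤ β) (p q : Plaquette d) :
    ‖correlation β p q‖ =
      Real.exp (-4 * Real.pi ^ 2 * β * (‖projDelta p‖ ^ 2 + ‖projDelta q‖ ^ 2)) *
        |Real.exp (-8 * Real.pi ^ 2 * β * (projDelta p).1 q) - 1| := by
  have h1 : ∀ p : Plaquette d, ∫ x, wilson p x ∂(latticeMeasure d β) =
      (Real.exp (-4 * Real.pi ^ 2 * β * ‖projDelta p‖ ^ 2) : ℝ) := by
    intro p
    rw [← integral_char_heatKernelMeasure hβ ⟨evalChar p, continuous_evalChar p⟩]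
    · exact integral_latticeMeasure β (f := fun c => (evalChar p c : ℂ))
        (continuous_subtype_val.comp (continuous_evalChar p))
    · intro y
      rw [inner_projDelta]
      exact evalChar_expMap p y
  have h2 : ∫ x, wilson p x * wilson q x ∂(latticeMeasure d β) =
      (Real.exp (-4 * Real.pi ^ 2 * β * ‖projDelta p + projDelta q‖ ^ 2) : ℝ) := by
    rw [← integral_char_heatKernelMeasure hβ
      ⟨evalChar p * evalChar q, (continuous_evalChar p).mul (continuous_evalChar q)⟩]
    · exact integral_latticeMeasure β (f := fun c => (evalChar p c : ℂ) * (evalChar q c : ℂ))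
        ((continuous_subtype_val.comp (continuous_evalChar p)).mul
          (continuous_subtype_val.comp (continuous_evalChar q)))
    · intro y
      rw [inner_add_left, inner_projDelta, inner_projDelta, mul_add, Circle.exp_add,
        AddChar.mul_apply, evalChar_expMap, evalChar_expMap]
      rfl
  rw [correlation, h1, h1, h2, ← Complex.ofReal_mul, ← Complex.ofReal_sub, Complex.norm_real,
    Real.norm_eq_abs, norm_add_sq_real, real_inner_comm, inner_projDelta]
  rw [← abs_of_pos (Real.exp_pos
    (-4 * Real.pi ^ 2 * β * (‖projDelta p‖ ^ 2 + ‖projDelta q‖ ^ 2))), ← abs_mul, mul_sub,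
    ← Real.exp_add, ← Real.exp_add, mul_one]
  congr 3 <;> ring

end Correlation

/-! ### Fourier analysis on the momentum torus -/

/-- The normalised Haar measure on the torus of momenta. -/
def torusMeasure (d : ℕ) : Measure (UnitAddTorus (Fin d)) :=
  Measure.pi fun _ => AddCircle.haarAddCircle

instance : IsProbabilityMeasure (torusMeasure d) := by unfold torusMeasure; infer_instance

lemma integrable_torus {E : Type*} [NormedAddCommGroup E] {f : UnitAddTorus (Fin d) → E}
    (hf : Continuous f) : Integrable f (torusMeasure d) :=
  hf.integrable_of_hasCompactSupport (HasCompactSupport.of_compactSpace f)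

lemma integral_fourier_haarAddCircle (n : ℤ) :
    ∫ t : UnitAddCircle, fourier n t ∂AddCircle.haarAddCircle = if n = 0 then 1 else 0 := by
  have h := congrFun (fourierCoeff_fourier (T := 1) n) 0
  simp only [fourierCoeff, neg_zero, fourier_zero, one_smul] at h
  rw [h, Pi.single_apply]
  simp only [eq_comm]

lemma integral_mFourier (n : Fin d → ℤ) :
    ∫ t, UnitAddTorus.mFourier n t ∂(torusMeasure d) = if n = 0 then 1 else 0 := by
  unfold torusMeasure UnitAddTorus.mFourier
  simp only [ContinuousMap.coe_mk]
  rw [integral_fintype_prod_eq_prod (𝕜 := ℂ) (fun i (x : UnitAddCircle) => fourier (n i) x)]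
  simp only [integral_fourier_haarAddCircle]
  rw [Finset.prod_ite_zero]
  simp [funext_iff]

/-- The real part of the plane wave with position `x` and momentum `k`. -/
def wave (x : Fin d → ℤ) (k : UnitAddTorus (Fin d)) : ℝ := (UnitAddTorus.mFourier x k).re

lemma continuous_wave (x : Fin d → ℤ) : Continuous (wave x) :=
  Complex.continuous_re.comp (UnitAddTorus.mFourier x).continuous

lemma abs_wave_le_one (x : Fin d → ℤ) (k : UnitAddTorus (Fin d)) : |wave x k| ≤ 1 :=
  (Complex.abs_re_le_norm _).trans
    (((UnitAddTorus.mFourier x).norm_coe_le_norm k).trans_eq UnitAddTorus.mFourier_norm)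

lemma wave_zero (k : UnitAddTorus (Fin d)) : wave 0 k = 1 := by
  simp [wave, UnitAddTorus.mFourier_zero]

lemma integral_wave (x : Fin d → ℤ) :
    ∫ k, wave x k ∂(torusMeasure d) = if x = 0 then 1 else 0 := by
  have h := integral_re (𝕜 := ℂ)
    (integrable_torus (d := d) (UnitAddTorus.mFourier x).continuous)
  rw [integral_mFourier] at h
  refine h.trans ?_
  split_ifs <;> simp

/-- The symbol `2 - 2 cos(2πt)` of the one-dimensional lattice Laplacian. -/
def symb (t : UnitAddCircle) : ℝ := 2 - 2 * (fourier 1 t : ℂ).re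

lemma continuous_symb : Continuous symb :=
  continuous_const.sub (continuous_const.mul (Complex.continuous_re.comp (fourier 1).continuous))

lemma wave_add_wave_sub (x : Fin d → ℤ) (l : Fin d) (k : UnitAddTorus (Fin d)) :
    2 * wave x k - wave (x + Pi.single l 1) k - wave (x - Pi.single l 1) k =
      symb (k l) * wave x k := by
  unfold wave symb
  rw [sub_eq_add_neg x, UnitAddTorus.mFourier_add, UnitAddTorus.mFourier_add,
    UnitAddTorus.mFourier_neg, UnitAddTorus.mFourier_single]
  simp only [Complex.mul_re, Complex.conj_re, Complex.conj_im]
  ring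

/-- The lattice operator `-Δ_l`, minus the second difference in direction `l`. -/
def negLap (l : Fin d) (h : (Fin d → ℤ) → ℝ) (x : Fin d → ℤ) : ℝ :=
  2 * h x - h (x + Pi.single l 1) - h (x - Pi.single l 1)

/-- The function on the lattice with Fourier transform `m`. -/
def invFourier (m : UnitAddTorus (Fin d) → ℝ) (x : Fin d → ℤ) : ℝ :=
  ∫ k, wave x k * m k ∂(torusMeasure d)

lemma negLap_invFourier {m : UnitAddTorus (Fin d) → ℝ} (hm : Continuous m) (l : Fin d)
    (x : Fin d → ℤ) :
    negLap l (invFourier m) x = invFourier (fun k => symb (k l) * m k) x := by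
  have hi : ∀ x, Integrable (fun k => wave x k * m k) (torusMeasure d) := fun x =>
    integrable_torus ((continuous_wave x).mul hm)
  have h : ∀ k, wave x k * (symb (k l) * m k) = 2 * (wave x k * m k) -
      wave (x + Pi.single l 1) k * m k - wave (x - Pi.single l 1) k * m k := by
    intro k
    rw [mul_left_comm, ← mul_assoc (symb (k l)), ← wave_add_wave_sub]
    ring
  unfold negLap invFourier
  simp only [h]
  rw [integral_sub, integral_sub, integral_const_mul]
  · exact (hi _).const_mul _
  · exact hi _
  · exact ((hi _).const_mul _).sub (hi _)
  · exact hi _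

lemma invFourier_const_mul (c : ℝ) (m : UnitAddTorus (Fin d) → ℝ) (x : Fin d → ℤ) :
    invFourier (fun k => c * m k) x = c * invFourier m x := by
  unfold invFourier
  rw [← integral_const_mul]
  simp only [mul_left_comm]

lemma invFourier_add {m m' : UnitAddTorus (Fin d) → ℝ} (hm : Continuous m) (hm' : Continuous m')
    (x : Fin d → ℤ) :
    invFourier (fun k => m k + m' k) x = invFourier m x + invFourier m' x := by
  unfold invFourier
  rw [← integral_add (integrable_torus ((continuous_wave x).fun_mul hm))
    (integrable_torus ((continuous_wave x).fun_mul hm'))]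
  simp only [mul_add]

lemma invFourier_sub {m m' : UnitAddTorus (Fin d) → ℝ} (hm : Continuous m) (hm' : Continuous m')
    (x : Fin d → ℤ) :
    invFourier (fun k => m k - m' k) x = invFourier m x - invFourier m' x := by
  unfold invFourier
  rw [← integral_sub (integrable_torus ((continuous_wave x).fun_mul hm))
    (integrable_torus ((continuous_wave x).fun_mul hm'))]
  simp only [mul_sub]

lemma invFourier_sum {ι : Type*} (s : Finset ι) {m : ι → UnitAddTorus (Fin d) → ℝ}
    (hm : ∀ l, Continuous (m l)) (x : Fin d → ℤ) :
    invFourier (fun k => ∑ l ∈ s, m l k) x = ∑ l ∈ s, invFourier (m l) x := by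
  unfold invFourier
  rw [← integral_finsetSum s fun l _ => integrable_torus ((continuous_wave x).fun_mul (hm l))]
  simp only [Finset.mul_sum]

lemma invFourier_one (x : Fin d → ℤ) :
    invFourier (fun _ => 1) x = if x = 0 then 1 else 0 := by
  unfold invFourier
  simp only [mul_one, integral_wave]

lemma abs_invFourier_le {m : UnitAddTorus (Fin d) → ℝ} {C : ℝ} (h0 : ∀ k, 0 ≤ m k)
    (h : ∀ k, m k ≤ C) (x : Fin d → ℤ) : |invFourier m x| ≤ C := by
  have := norm_integral_le_of_norm_le_const (μ := torusMeasure d) (C := C)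
    (f := fun k => wave x k * m k) (ae_of_all _ fun k => by
      rw [norm_mul, Real.norm_eq_abs, Real.norm_eq_abs, abs_of_nonneg (h0 k)]
      exact (mul_le_of_le_one_left (h0 k) (abs_wave_le_one _ _)).trans (h k))
  rwa [probReal_univ, mul_one] at this

lemma summable_sq_invFourier {m : UnitAddTorus (Fin d) → ℝ} (hm : Continuous m) :
    Summable fun x => invFourier m x ^ 2 := by
  let f : C(UnitAddTorus (Fin d), ℂ) := ⟨fun k => (m k : ℂ), Complex.continuous_ofReal.comp hm⟩
  have h : Summable fun n => ‖UnitAddTorus.mFourierCoeff f n‖ ^ 2 :=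
    (UnitAddTorus.hasSum_sq_mFourierCoeff
      (ContinuousMap.toLp 2 (torusMeasure d) ℂ f)).summable.congr fun n =>
        congrArg (‖·‖ ^ 2) (UnitAddTorus.mFourierCoeff_toLp f n)
  have h2 := h.comp_injective (neg_injective (G := Fin d → ℤ))
  refine Summable.of_nonneg_of_le (fun x => sq_nonneg _) (fun x => ?_) h2
  have h3 : UnitAddTorus.mFourierCoeff f (-x) =
      ∫ k, UnitAddTorus.mFourier x k * (m k : ℂ) ∂(torusMeasure d) := by
    rw [← neg_neg x]
    simp only [neg_neg (-x)]
    rfl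
  have h4 : invFourier m x = (UnitAddTorus.mFourierCoeff f (-x)).re := by
    rw [h3]
    have := integral_re (𝕜 := ℂ) (integrable_torus (d := d)
      ((UnitAddTorus.mFourier x).continuous.mul (Complex.continuous_ofReal.comp hm)))
    refine Eq.trans ?_ this
    unfold invFourier wave
    congr 1
    funext k
    simp
  rw [Function.comp_apply, h4, ← sq_abs]
  exact pow_le_pow_left₀ (abs_nonneg _) (Complex.abs_re_le_norm _) 2

lemma symb_coe (r : ℝ) : symb (r : UnitAddCircle) = 2 - 2 * Real.cos (2 * Real.pi * r) := by
  unfold symb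
  rw [fourier_coe_apply]
  have : 2 * (Real.pi : ℂ) * Complex.I * ((1 : ℤ) : ℂ) * (r : ℂ) / ((1 : ℝ) : ℂ) =
      ((2 * Real.pi * r : ℝ) : ℂ) * Complex.I := by
    push_cast
    ring
  rw [this, Complex.exp_ofReal_mul_I_re]

lemma exists_abs_le_half (t : UnitAddCircle) :
    ∃ r : ℝ, t = (r : UnitAddCircle) ∧ ‖t‖ = |r| ∧ |r| ≤ 1 / 2 := by
  obtain ⟨x, rfl⟩ := QuotientAddGroup.mk_surjective t
  refine ⟨x - round x, ?_, ?_, abs_sub_round x⟩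
  · have : ((round x : ℝ) : UnitAddCircle) = 0 := by
      rw [AddCircle.coe_eq_zero_iff]
      exact ⟨round x, by simp⟩
    rw [AddCircle.coe_sub, this, sub_zero]
  · exact UnitAddCircle.norm_eq

lemma symb_nonneg (t : UnitAddCircle) : 0 ≤ symb t := by
  obtain ⟨r, rfl, -, -⟩ := exists_abs_le_half t
  rw [symb_coe]
  linarith [Real.cos_le_one (2 * Real.pi * r)]

lemma symb_le (t : UnitAddCircle) : symb t ≤ 40 * ‖t‖ ^ 2 := by
  obtain ⟨r, rfl, hr, -⟩ := exists_abs_le_half t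
  rw [symb_coe, hr, sq_abs]
  have h1 := Real.one_sub_sq_div_two_le_cos (x := 2 * Real.pi * r)
  have h2 : Real.pi ^ 2 ≤ 10 := by nlinarith [Real.pi_lt_d2, Real.pi_pos]
  nlinarith [sq_nonneg r]

lemma le_symb (t : UnitAddCircle) : 16 * ‖t‖ ^ 2 ≤ symb t := by
  obtain ⟨r, rfl, hr, hr'⟩ := exists_abs_le_half t
  rw [symb_coe, hr, sq_abs]
  have hpi := Real.pi_pos
  have h1 := Real.cos_le_one_sub_mul_cos_sq (x := 2 * Real.pi * r) (by
    rw [abs_mul, abs_of_pos (by positivity)]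
    nlinarith)
  have h2 : 2 / Real.pi ^ 2 * (2 * Real.pi * r) ^ 2 = 8 * r ^ 2 := by
    field_simp
    norm_num
    ring
  rw [h2] at h1
  linarith

/-! ### The massive lattice Green function -/

/-- The Green function of `-Δ + ε` on `ℤ^d`. -/
def green (d : ℕ) (ε : ℝ) : (Fin d → ℤ) → ℝ :=
  invFourier fun k => (∑ l, symb (k l) + ε)⁻¹

lemma sum_symb_add_pos {ε : ℝ} (hε : 0 < ε) (k : UnitAddTorus (Fin d)) :
    0 < ∑ l, symb (k l) + ε :=
  add_pos_of_nonneg_of_pos (Finset.sum_nonneg fun _ _ => symb_nonneg _) hε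

lemma continuous_green_symbol {ε : ℝ} (hε : 0 < ε) :
    Continuous fun k : UnitAddTorus (Fin d) => (∑ l, symb (k l) + ε)⁻¹ := by
  refine Continuous.inv₀ ?_ fun k => (sum_symb_add_pos hε k).ne'
  exact (continuous_finsetSum _ fun l _ => continuous_symb.comp (continuous_apply l)).add
    continuous_const

lemma summable_sq_green {ε : ℝ} (hε : 0 < ε) : Summable fun x => green d ε x ^ 2 :=
  summable_sq_invFourier (continuous_green_symbol hε)

lemma negLap_green {ε : ℝ} (hε : 0 < ε) (x : Fin d → ℤ) :
    ∑ l, negLap l (green d ε) x + ε * green d ε x = if x = 0 then 1 else 0 := by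
  have hc := continuous_green_symbol (d := d) hε
  have hcs : ∀ l : Fin d, Continuous fun k : UnitAddTorus (Fin d) => symb (k l) := fun l =>
    continuous_symb.comp (continuous_apply l)
  unfold green
  simp only [negLap_invFourier hc]
  rw [← invFourier_sum _ (fun l => (hcs l).fun_mul hc), ← invFourier_const_mul,
    ← invFourier_add (continuous_finsetSum _ fun l _ => (hcs l).fun_mul hc)
      (continuous_const.fun_mul hc),
    ← invFourier_one]
  congr 1
  funext k
  rw [← Finset.sum_mul, ← add_mul, mul_inv_cancel₀ (sum_symb_add_pos hε k).ne']

/-- Bounded solutions of `(-Δ + ε) h = 0` vanish, by the maximum principle. -/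
lemma eq_zero_of_negLap_eq_zero {ε : ℝ} (hε : 0 < ε) {h : (Fin d → ℤ) → ℝ} {C : ℝ}
    (hC : ∀ x, |h x| ≤ C) (heq : ∀ x, ∑ l, negLap l h x + ε * h x = 0) : h = 0 := by
  have hbdd : BddAbove (Set.range fun x => |h x|) := ⟨C, by rintro _ ⟨x, rfl⟩; exact hC x⟩
  let M := ⨆ x, |h x|
  have hM : ∀ x, |h x| ≤ M := fun x => le_ciSup hbdd x
  have hM0 : 0 ≤ M := (abs_nonneg _).trans (hM 0)
  have h1 : ∀ x, (2 * d + ε) * |h x| ≤ 2 * d * M := by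
    intro x
    have h2 : (2 * d + ε) * h x = ∑ l : Fin d, (h (x + Pi.single l 1) + h (x - Pi.single l 1)) := by
      have := heq x
      simp only [negLap, Finset.sum_sub_distrib, Finset.sum_const, Finset.card_univ,
        Fintype.card_fin, nsmul_eq_mul] at this
      rw [Finset.sum_add_distrib]
      linarith
    have h3 : |(2 * d + ε) * h x| ≤ ∑ _l : Fin d, (M + M) := by
      rw [h2]
      refine (Finset.abs_sum_le_sum_abs _ _).trans (Finset.sum_le_sum fun l _ => ?_)
      exact (abs_add_le _ _).trans (add_le_add (hM _) (hM _))
    rw [abs_mul, abs_of_pos (by positivity)] at h3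
    refine h3.trans_eq ?_
    simp only [Finset.sum_const, Finset.card_univ, Fintype.card_fin, nsmul_eq_mul]
    ring
  have h4 : (2 * d + ε) * M ≤ 2 * d * M := by
    have h5 : M ≤ 2 * d * M / (2 * d + ε) := ciSup_le fun x => by
      rw [le_div_iff₀ (by positivity), mul_comm]
      exact h1 x
    rwa [le_div_iff₀ (by positivity), mul_comm] at h5
  have h6 : M ≤ 0 := by nlinarith
  funext x
  exact abs_nonpos_iff.1 ((hM x).trans h6)

/-! ### Transverse representation of the Green function -/

/-- The decay rate `λ < 1` with `λ + λ⁻¹ = 2 + s`. -/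
def decayRate (s : ℝ) : ℝ := 1 + s / 2 - √(s + s ^ 2 / 4)

/-- The one-dimensional massive Green function `λ^n / (λ⁻¹ - λ)`. -/
def green1 (n : ℕ) (s : ℝ) : ℝ := decayRate s ^ n / (2 * √(s + s ^ 2 / 4))

lemma sq_sqrt_disc {s : ℝ} (hs : 0 < s) : √(s + s ^ 2 / 4) ^ 2 = s + s ^ 2 / 4 :=
  Real.sq_sqrt (by positivity)

lemma decayRate_pos {s : ℝ} (hs : 0 < s) : 0 < decayRate s := by
  unfold decayRate
  rw [sub_pos, Real.sqrt_lt' (by positivity)]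
  nlinarith

lemma decayRate_le_one {s : ℝ} (hs : 0 < s) : decayRate s ≤ 1 := by
  unfold decayRate
  have : s / 2 ≤ √(s + s ^ 2 / 4) := Real.le_sqrt_of_sq_le (by nlinarith)
  linarith

lemma decayRate_sq {s : ℝ} (hs : 0 < s) :
    decayRate s ^ 2 - (2 + s) * decayRate s + 1 = 0 := by
  have := sq_sqrt_disc hs
  unfold decayRate
  nlinarith

lemma green1_zero_eq {s : ℝ} (hs : 0 < s) : (2 + s) * green1 0 s - 2 * green1 1 s = 1 := by
  have hR : 0 < √(s + s ^ 2 / 4) := Real.sqrt_pos.2 (by positivity)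
  unfold green1 decayRate
  rw [pow_zero, pow_one, ← mul_div_assoc, ← mul_div_assoc, ← sub_div,
    div_eq_one_iff_eq (by positivity)]
  ring

lemma green1_succ_eq {s : ℝ} (hs : 0 < s) (n : ℕ) :
    (2 + s) * green1 (n + 1) s - green1 (n + 2) s - green1 n s = 0 := by
  have h := decayRate_sq hs
  unfold green1
  rw [← mul_div_assoc, ← sub_div, ← sub_div]
  have : (2 + s) * decayRate s ^ (n + 1) - decayRate s ^ (n + 2) - decayRate s ^ n =
      -(decayRate s ^ n * (decayRate s ^ 2 - (2 + s) * decayRate s + 1)) := by ring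
  rw [this, h]
  simp

lemma green1_nonneg {s : ℝ} (hs : 0 < s) (n : ℕ) : 0 ≤ green1 n s := by
  have := decayRate_pos hs
  unfold green1
  positivity

lemma green1_le {s ε : ℝ} (hε : 0 < ε) (hs : ε ≤ s) (n : ℕ) : green1 n s ≤ 1 / (2 * √ε) := by
  have hs0 := hε.trans_le hs
  unfold green1
  have h1 : √ε ≤ √(s + s ^ 2 / 4) := Real.sqrt_le_sqrt (by nlinarith)
  have h2 : 0 < √ε := Real.sqrt_pos.2 hε
  exact div_le_div₀ zero_le_one (pow_le_one₀ (decayRate_pos hs0).le (decayRate_le_one hs0))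
    (by positivity) (by linarith)

lemma continuousOn_green1 (n : ℕ) : ContinuousOn (green1 n) (Set.Ioi 0) := by
  unfold green1 decayRate
  refine ContinuousOn.div (by fun_prop) (by fun_prop) fun s hs => ?_
  have : 0 < s := hs
  positivity

/-- On the scale `s ~ n⁻²` the one-dimensional Green function has size `n`. -/
lemma le_green1 {s : ℝ} {n : ℕ} (hs : 0 < s) (hn : 1 ≤ n) (h : s ≤ 1 / (8 * n ^ 2)) :
    (n : ℝ) / 2 ≤ green1 n s := by
  have hn' : (1 : ℝ) ≤ n := by exact_mod_cast hn
  set R := √(s + s ^ 2 / 4) with hRdef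
  have hR : 0 < R := Real.sqrt_pos.2 (by positivity)
  have hRle : R ≤ 1 / (2 * n) := by
    apply Real.sqrt_le_iff.2 ⟨by positivity, ?_⟩
    have h1 : s ≤ 1 := h.trans (by
      rw [div_le_one (by positivity)]
      nlinarith)
    have h2 : (1 / (2 * (n : ℝ))) ^ 2 = 2 * (1 / (8 * n ^ 2)) := by
      field_simp
      norm_num
    rw [h2]
    nlinarith
  have hnR : n * R ≤ 1 / 2 := by
    rw [le_div_iff₀ (by positivity)] at hRle
    linarith
  have h1 : 1 - n * R ≤ decayRate s ^ n := by
    have hb := one_add_mul_le_pow (a := -R) (by nlinarith) n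
    refine le_trans (by linarith) (hb.trans (pow_le_pow_left₀ ?_ ?_ n))
    · nlinarith
    · unfold decayRate
      linarith
  unfold green1
  rw [← hRdef, le_div_iff₀ (by positivity)]
  nlinarith

section Transverse

variable (i : Fin d)

/-- The transverse squared mass `ε + ∑_{l ≠ i} (2 - 2 cos(2πk_l))`. -/
def transMass (ε : ℝ) (k : UnitAddTorus (Fin d)) : ℝ :=
  ε + ∑ l ∈ Finset.univ.erase i, symb (k l)

lemma le_transMass (ε : ℝ) (k : UnitAddTorus (Fin d)) : ε ≤ transMass i ε k :=
  le_add_of_nonneg_right (Finset.sum_nonneg fun _ _ => symb_nonneg _)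

/-- The Green function computed by a Fourier transform in the directions other than `i` only. The
variable `k_i` of the integral is a dummy. -/
def transGreen (ε : ℝ) (x : Fin d → ℤ) : ℝ :=
  invFourier (fun k => green1 (x i).natAbs (transMass i ε k)) (Function.update x i 0)

variable {ε : ℝ}

lemma continuous_green1_transMass (hε : 0 < ε) (n : ℕ) :
    Continuous fun k : UnitAddTorus (Fin d) => green1 n (transMass i ε k) := by
  refine (continuousOn_green1 n).comp_continuous ?_ fun k => hε.trans_le (le_transMass i ε k)
  exact continuous_const.add (continuous_finsetSum _ fun l _ =>
    continuous_symb.comp (continuous_apply l))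

lemma abs_transGreen_le (hε : 0 < ε) (x : Fin d → ℤ) : |transGreen i ε x| ≤ 1 / (2 * √ε) :=
  abs_invFourier_le (fun k => green1_nonneg (hε.trans_le (le_transMass i ε k)) _)
    (fun k => green1_le hε (le_transMass i ε k) _) _

lemma negLap_transGreen_of_ne (hε : 0 < ε) {l : Fin d} (hl : l ≠ i) (x : Fin d → ℤ) :
    negLap l (transGreen i ε) x =
      invFourier (fun k => symb (k l) * green1 (x i).natAbs (transMass i ε k))
        (Function.update x i 0) := by
  rw [← negLap_invFourier (continuous_green1_transMass i hε _)]
  have h1 : Function.update (x + Pi.single l 1) i 0 = Function.update x i 0 + Pi.single l 1 := by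
    funext m
    by_cases hm : m = i
    · subst hm; simp [hl.symm]
    · simp [hm]
  have h2 : Function.update (x - Pi.single l 1) i 0 = Function.update x i 0 - Pi.single l 1 := by
    funext m
    by_cases hm : m = i
    · subst hm; simp [hl.symm]
    · simp [hm]
  simp only [negLap, transGreen, h1, h2, Pi.add_apply, Pi.sub_apply, Pi.single_eq_of_ne hl.symm,
    add_zero, sub_zero]

lemma negLap_transGreen_self (hε : 0 < ε) (x : Fin d → ℤ) :
    negLap i (transGreen i ε) x =
      (if x = 0 then 1 else 0) - invFourier (fun k => transMass i ε k *
        green1 (x i).natAbs (transMass i ε k)) (Function.update x i 0) := by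
  have h1 : Function.update (x + Pi.single i 1) i 0 = Function.update x i 0 := by
    funext m
    by_cases hm : m = i
    · subst hm; simp
    · simp [hm]
  have h2 : Function.update (x - Pi.single i 1) i 0 = Function.update x i 0 := by
    funext m
    by_cases hm : m = i
    · subst hm; simp
    · simp [hm]
  have hc := continuous_green1_transMass (d := d) i hε
  have hct : Continuous (transMass (d := d) i ε) :=
    continuous_const.add (continuous_finsetSum _ fun l _ =>
      continuous_symb.comp (continuous_apply l))
  have key : ∀ s : ℝ, 0 < s → 2 * green1 (x i).natAbs s - green1 (x i + 1).natAbs s -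
      green1 (x i - 1).natAbs s = (if x i = 0 then 1 else 0) - s * green1 (x i).natAbs s := by
    intro s hs
    rcases lt_trichotomy (x i) 0 with h | h | h
    · obtain ⟨n, hn⟩ : ∃ n : ℕ, x i = -(n + 1 : ℤ) := ⟨(x i).natAbs - 1, by omega⟩
      have e1 : (x i).natAbs = n + 1 := by omega
      have e2 : (x i + 1).natAbs = n := by omega
      have e3 : (x i - 1).natAbs = n + 2 := by omega
      rw [e1, e2, e3, if_neg h.ne]
      linarith [green1_succ_eq hs n]
    · rw [h]
      simp only [Int.natAbs_zero, zero_add, zero_sub, Int.natAbs_one, Int.natAbs_neg, if_true]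
      linarith [green1_zero_eq hs]
    · obtain ⟨n, hn⟩ : ∃ n : ℕ, x i = (n + 1 : ℤ) := ⟨(x i).natAbs - 1, by omega⟩
      have e1 : (x i).natAbs = n + 1 := by omega
      have e2 : (x i + 1).natAbs = n + 2 := by omega
      have e3 : (x i - 1).natAbs = n := by omega
      rw [e1, e2, e3, if_neg h.ne']
      linarith [green1_succ_eq hs n]
  simp only [negLap, transGreen, h1, h2, Pi.add_apply, Pi.sub_apply, Pi.single_eq_same]
  rw [← invFourier_const_mul, ← invFourier_sub (continuous_const.fun_mul (hc _)) (hc _),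
    ← invFourier_sub ((continuous_const.fun_mul (hc _)).fun_sub (hc _)) (hc _)]
  have h3 : ∀ k, 2 * green1 (x i).natAbs (transMass i ε k) -
      green1 (x i + 1).natAbs (transMass i ε k) - green1 (x i - 1).natAbs (transMass i ε k) =
      (if x i = 0 then 1 else 0) * 1 - transMass i ε k * green1 (x i).natAbs (transMass i ε k) :=
    fun k => by rw [key _ (hε.trans_le (le_transMass i ε k)), mul_one]
  simp only [h3]
  rw [invFourier_sub continuous_const (hct.fun_mul (hc _)), invFourier_const_mul, invFourier_one]
  congr 1
  by_cases hx : x i = 0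
  · rw [← hx, Function.update_eq_self]
    simp [hx]
  · have : x ≠ 0 := fun h => hx (by rw [h]; rfl)
    simp [hx, this]

lemma negLap_transGreen (hε : 0 < ε) (x : Fin d → ℤ) :
    ∑ l, negLap l (transGreen i ε) x + ε * transGreen i ε x = if x = 0 then 1 else 0 := by
  have hc := continuous_green1_transMass (d := d) i hε (x i).natAbs
  have hcs : ∀ l : Fin d, Continuous fun k : UnitAddTorus (Fin d) => symb (k l) := fun l =>
    continuous_symb.comp (continuous_apply l)
  rw [← Finset.add_sum_erase _ _ (Finset.mem_univ i), negLap_transGreen_self i hε,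
    Finset.sum_congr rfl fun l hl =>
      negLap_transGreen_of_ne i hε (Finset.ne_of_mem_erase hl) x]
  have h : ∀ k, transMass i ε k * green1 (x i).natAbs (transMass i ε k) =
      ε * green1 (x i).natAbs (transMass i ε k) + ∑ l ∈ Finset.univ.erase i,
        symb (k l) * green1 (x i).natAbs (transMass i ε k) := fun k => by
    rw [← Finset.sum_mul, ← add_mul]
    rfl
  simp only [h]
  rw [invFourier_add (continuous_const.fun_mul hc)
      (continuous_finsetSum _ fun l _ => (hcs l).fun_mul hc),
    invFourier_const_mul, invFourier_sum _ fun l => (hcs l).fun_mul hc]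
  unfold transGreen
  ring

/-- The Green function has the transverse representation, by uniqueness of bounded solutions. -/
lemma green_eq_transGreen (hε : 0 < ε) : green d ε = transGreen i ε := by
  have h : (fun x => green d ε x - transGreen i ε x) = 0 := by
    refine eq_zero_of_negLap_eq_zero (C := 1 / ε + 1 / (2 * √ε)) hε (fun x => ?_) fun x => ?_
    · refine (abs_sub _ _).trans (add_le_add ?_ (abs_transGreen_le i hε x))
      refine abs_invFourier_le (fun k => (inv_pos.2 (sum_symb_add_pos hε k)).le) (fun k => ?_) x
      rw [one_div]
      exact inv_anti₀ hε (le_add_of_nonneg_left (Finset.sum_nonneg fun _ _ => symb_nonneg _))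
    · have h1 := negLap_green hε x
      have h2 := negLap_transGreen i hε x
      have h3 : ∀ l, negLap l (fun x => green d ε x - transGreen i ε x) x =
          negLap l (green d ε) x - negLap l (transGreen i ε) x := fun l => by
        simp only [negLap]; ring
      simp only [h3, Finset.sum_sub_distrib]
      linarith
  funext x
  exact sub_eq_zero.1 (congrFun h x)

end Transverse

/-! ### Lower bounds for second differences of the Green function -/

lemma green_zero_le (i : Fin d) {ε : ℝ} (hε : 0 < ε) : green d ε 0 ≤ 1 / (2 * √ε) := by
  rw [green_eq_transGreen i hε]
  exact (le_abs_self _).trans (abs_transGreen_le i hε 0)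

lemma invFourier_zero (m : UnitAddTorus (Fin d) → ℝ) :
    invFourier m 0 = ∫ k, m k ∂(torusMeasure d) := by
  simp only [invFourier, wave_zero, one_mul]

lemma update_single_self (i : Fin d) (m : ℤ) :
    Function.update (Pi.single i m : Fin d → ℤ) i 0 = 0 := by
  funext l
  by_cases hl : l = i
  · subst hl; simp
  · simp [hl]

lemma green_single_nonneg (i : Fin d) {ε : ℝ} (hε : 0 < ε) (m : ℤ) :
    0 ≤ green d ε (Pi.single i m) := by
  rw [green_eq_transGreen i hε, transGreen, update_single_self, invFourier_zero]
  exact integral_nonneg fun k => green1_nonneg (hε.trans_le (le_transMass i ε k)) _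

lemma negLap_green_single (i : Fin d) {ε : ℝ} (hε : 0 < ε) {l : Fin d} (hl : l ≠ i) (m : ℤ) :
    negLap l (green d ε) (Pi.single i m) =
      ∫ k, symb (k l) * green1 m.natAbs (transMass i ε k) ∂(torusMeasure d) := by
  rw [green_eq_transGreen i hε, negLap_transGreen_of_ne i hε hl, update_single_self,
    invFourier_zero, Pi.single_eq_same]

lemma negLap_green_single_nonneg (i : Fin d) {ε : ℝ} (hε : 0 < ε) {l : Fin d} (hl : l ≠ i)
    (m : ℤ) : 0 ≤ negLap l (green d ε) (Pi.single i m) := by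
  rw [negLap_green_single i hε hl]
  exact integral_nonneg fun k =>
    mul_nonneg (symb_nonneg _) (green1_nonneg (hε.trans_le (le_transMass i ε k)) _)

/-- The box of momenta with all transverse components of norm in `[r/2, r]`. -/
def momentumBox (i : Fin d) (r : ℝ) : Set (UnitAddTorus (Fin d)) :=
  Set.pi Set.univ fun l => if l = i then Set.univ else
    Metric.closedBall ((3 * r / 4 : ℝ) : UnitAddCircle) (r / 4)

lemma measurableSet_momentumBox (i : Fin d) (r : ℝ) : MeasurableSet (momentumBox i r) := by
  refine MeasurableSet.univ_pi fun l => ?_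
  split_ifs
  · exact MeasurableSet.univ
  · exact Metric.isClosed_closedBall.measurableSet

lemma measureReal_momentumBox (i : Fin d) {r : ℝ} (hr : 0 < r) (hr' : r ≤ 1 / 2) :
    (torusMeasure d).real (momentumBox i r) = (r / 2) ^ (d - 1) := by
  have h1 : ∀ x : UnitAddCircle, AddCircle.haarAddCircle (Metric.closedBall x (r / 4)) =
      ENNReal.ofReal (r / 2) := by
    intro x
    have h := AddCircle.volume_closedBall 1 (x := x) (r / 4)
    rw [AddCircle.volume_eq_smul_haarAddCircle, ENNReal.ofReal_one, one_smul] at h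
    rw [h, min_eq_right (by linarith)]
    congr 1
    ring
  rw [measureReal_def, momentumBox, torusMeasure, Measure.pi_pi,
    ← Finset.mul_prod_erase _ _ (Finset.mem_univ i), if_pos rfl, measure_univ, one_mul,
    Finset.prod_congr rfl fun l hl => by rw [if_neg (Finset.ne_of_mem_erase hl), h1],
    Finset.prod_const, Finset.card_erase_of_mem (Finset.mem_univ i), Finset.card_univ,
    Fintype.card_fin, ENNReal.toReal_pow, ENNReal.toReal_ofReal (by positivity)]

lemma norm_mem_of_mem_momentumBox {i l : Fin d} (hl : l ≠ i) {r : ℝ} (hr : 0 < r)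
    (hr' : r ≤ 1 / 2) {k : UnitAddTorus (Fin d)} (hk : k ∈ momentumBox i r) :
    r / 2 ≤ ‖k l‖ ∧ ‖k l‖ ≤ r := by
  have h := hk l trivial
  simp only [if_neg hl, mem_closedBall_iff_norm] at h
  have hc : ‖((3 * r / 4 : ℝ) : UnitAddCircle)‖ = 3 * r / 4 := by
    rw [UnitAddCircle.norm_eq]
    have : round (3 * r / 4) = 0 := by
      rw [round_eq_zero_iff]
      constructor <;> linarith
    rw [this, Int.cast_zero, sub_zero, abs_of_pos (by positivity)]
  have h1 := norm_sub_norm_le (k l) ((3 * r / 4 : ℝ) : UnitAddCircle)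
  have h2 := norm_sub_norm_le ((3 * r / 4 : ℝ) : UnitAddCircle) (k l)
  rw [norm_sub_rev] at h2
  constructor <;> linarith

/-- The transverse second differences of the massive Green function decay no faster than `n^{-d}`
along an axis, uniformly in the mass as long as it is at most of order `n⁻¹`. The momenta of size
`n⁻¹` are responsible. -/
lemma exists_le_negLap_green (hd : 0 < d) : ∃ C : ℝ, 0 < C ∧ ∀ (n : ℕ), 1 ≤ n →
    ∀ ε : ℝ, 0 < ε → ε ≤ 1 / (16 * n ^ 2) → ∀ (i l : Fin d), l ≠ i → ∀ m : ℤ, m.natAbs = n →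
      C / n ^ d ≤ negLap l (green d ε) (Pi.single i m) := by
  have hd' : (1 : ℝ) ≤ d := by exact_mod_cast hd
  -- With transverse momenta of norm at most `a / n` the transverse mass is at most `1 / (8 n²)`.
  set a : ℝ := 1 / (26 * d) with ha
  have ha0 : 0 < a := by positivity
  have had : 640 * d * a ^ 2 ≤ 1 := by
    rw [ha, div_pow, one_pow, mul_one_div, div_le_one (by positivity)]
    nlinarith
  have ha1 : a ≤ 1 / 2 := by
    rw [ha]
    apply one_div_le_one_div_of_le <;> linarith
  refine ⟨2 * a ^ 2 * (a / 2) ^ (d - 1), by positivity, fun n hn ε hε hεn i l hl m hm => ?_⟩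
  have hn' : (1 : ℝ) ≤ n := by exact_mod_cast hn
  have hr0 : 0 < a / n := by positivity
  have hr1 : a / n ≤ 1 / 2 := (div_le_self ha0.le hn').trans ha1
  rw [negLap_green_single i hε hl, hm]
  have hbound : ∀ k, (momentumBox i (a / n)).indicator (fun _ => 2 * a ^ 2 / n) k ≤
      symb (k l) * green1 n (transMass i ε k) := by
    intro k
    have hs : 0 < transMass i ε k := hε.trans_le (le_transMass i ε k)
    by_cases hk : k ∈ momentumBox i (a / n)
    · rw [Set.indicator_of_mem hk]
      have h1 : 16 * (a / n / 2) ^ 2 ≤ symb (k l) := by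
        refine le_trans ?_ (le_symb _)
        have := (norm_mem_of_mem_momentumBox hl hr0 hr1 hk).1
        gcongr
      have h2 : transMass i ε k ≤ 1 / (8 * n ^ 2) := by
        have h3 : ∑ l ∈ Finset.univ.erase i, symb (k l) ≤
            ∑ _l ∈ Finset.univ.erase i, 40 * (a / n) ^ 2 := by
          refine Finset.sum_le_sum fun l hl => (symb_le _).trans ?_
          have := (norm_mem_of_mem_momentumBox (Finset.ne_of_mem_erase hl) hr0 hr1 hk).2
          gcongr
        have h4 : ∑ _l ∈ Finset.univ.erase i, 40 * (a / n) ^ 2 ≤ d * (40 * (a / n) ^ 2) := by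
          rw [Finset.sum_const, nsmul_eq_mul]
          gcongr
          exact (Finset.card_le_univ _).trans_eq (Fintype.card_fin d)
        have h5 : d * (40 * (a / n) ^ 2) ≤ 1 / (16 * n ^ 2) := by
          rw [le_div_iff₀ (by positivity)]
          have : d * (40 * (a / n) ^ 2) * (16 * (n : ℝ) ^ 2) = 640 * d * a ^ 2 := by
            field_simp
            ring
          rw [this]
          exact had
        have h6 : 1 / (16 * (n : ℝ) ^ 2) + 1 / (16 * n ^ 2) = 1 / (8 * n ^ 2) := by
          field_simp
          norm_num
        unfold transMass
        linarith
      have h7 := le_green1 hs hn h2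
      calc 2 * a ^ 2 / n = 16 * (a / n / 2) ^ 2 * (n / 2) := by field_simp; ring
        _ ≤ _ := mul_le_mul h1 h7 (by positivity) (symb_nonneg _)
    · rw [Set.indicator_of_notMem hk]
      exact mul_nonneg (symb_nonneg _) (green1_nonneg hs _)
  have hint := integral_mono (μ := torusMeasure d)
    ((integrable_const (2 * a ^ 2 / n : ℝ)).indicator (measurableSet_momentumBox i (a / n)))
    (integrable_torus ((continuous_symb.comp (continuous_apply l)).mul
      (continuous_green1_transMass i hε n))) hbound
  rw [integral_indicator_const _ (measurableSet_momentumBox i (a / n)),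
    measureReal_momentumBox i hr0 hr1, smul_eq_mul] at hint
  refine le_trans (le_of_eq ?_) hint
  clear_value a
  obtain ⟨d', rfl⟩ : ∃ d', d = d' + 1 := ⟨d - 1, by omega⟩
  rw [Nat.add_sub_cancel, div_right_comm a (n : ℝ) 2, div_pow (a / 2) (n : ℝ), pow_succ (n : ℝ)]
  field_simp

/-! ### Summation by parts on `ℤ^d` -/

section Pairing

/-- Square summability of functions on the lattice. -/
def SqSummable (f : (Fin d → ℤ) → ℝ) : Prop := Summable fun v => f v ^ 2

/-- The `ℓ²` pairing of functions on the lattice. -/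
def pair (f g : (Fin d → ℤ) → ℝ) : ℝ := ∑' v, f v * g v

variable {f g h : (Fin d → ℤ) → ℝ}

lemma SqSummable.summable_mul (hf : SqSummable f) (hg : SqSummable g) :
    Summable fun v => f v * g v := by
  refine Summable.of_norm_bounded (Summable.add hf hg) fun v => ?_
  rw [Real.norm_eq_abs, abs_mul, ← sq_abs (f v), ← sq_abs (g v)]
  nlinarith [sq_nonneg (|f v| - |g v|), abs_nonneg (f v), abs_nonneg (g v)]

lemma SqSummable.comp_add (hf : SqSummable f) (w : Fin d → ℤ) :
    SqSummable fun v => f (v + w) :=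
  Summable.comp_injective (f := fun v => f v ^ 2) hf (add_left_injective w)

lemma SqSummable.comp_sub (hf : SqSummable f) (w : Fin d → ℤ) :
    SqSummable fun v => f (v - w) :=
  Summable.comp_injective (f := fun v => f v ^ 2) hf (sub_left_injective (b := w))

lemma SqSummable.sub (hf : SqSummable f) (hg : SqSummable g) :
    SqSummable fun v => f v - g v := by
  have := (Summable.add hf hg).sub ((hf.summable_mul hg).mul_left 2)
  exact this.congr fun v => by ring

lemma SqSummable.negLap (hf : SqSummable f) (l : Fin d) : SqSummable (negLap l f) := by
  have h1 := (hf.sub (hf.comp_add (Pi.single l 1))).sub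
    ((hf.comp_sub (Pi.single l 1)).sub hf)
  exact Summable.congr h1 fun v => by simp only [LatticeGauge.negLap]; ring

lemma pair_comm (f g : (Fin d → ℤ) → ℝ) : pair f g = pair g f := by
  unfold pair
  simp only [mul_comm]

lemma pair_sub_right (hf : SqSummable f) (hg : SqSummable g) (hh : SqSummable h) :
    pair f (fun v => g v - h v) = pair f g - pair f h := by
  unfold pair
  rw [← (hf.summable_mul hg).tsum_sub (hf.summable_mul hh)]
  simp only [mul_sub]

lemma pair_sub_left (hf : SqSummable f) (hg : SqSummable g) (hh : SqSummable h) :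
    pair (fun v => g v - h v) f = pair g f - pair h f := by
  rw [pair_comm, pair_sub_right hf hg hh, pair_comm f, pair_comm f]

lemma pair_add_shift (f g : (Fin d → ℤ) → ℝ) (w : Fin d → ℤ) :
    pair f (fun v => g (v + w)) = pair (fun v => f (v - w)) g := by
  unfold pair
  rw [← (Equiv.addRight w).tsum_eq fun v => f (v - w) * g v]
  simp

lemma pair_sub_shift (f g : (Fin d → ℤ) → ℝ) (w : Fin d → ℤ) :
    pair f (fun v => g (v - w)) = pair (fun v => f (v + w)) g := by
  rw [pair_comm, ← pair_add_shift, pair_comm]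

lemma pair_neg_right (f g : (Fin d → ℤ) → ℝ) : pair f (fun v => -g v) = -pair f g := by
  simp only [pair, mul_neg, tsum_neg]

lemma pair_finset_sum_left {ι : Type*} (s : Finset ι) {F : ι → (Fin d → ℤ) → ℝ}
    (hF : ∀ a, SqSummable (F a)) (hg : SqSummable g) :
    pair (fun v => ∑ a ∈ s, F a v) g = ∑ a ∈ s, pair (F a) g := by
  unfold pair
  rw [← Summable.tsum_finsetSum fun a _ => (hF a).summable_mul hg]
  simp only [Finset.sum_mul]

lemma sqSummable_mixed (hf : SqSummable f) (a b : Fin d → ℤ) :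
    SqSummable fun v => (f (v - a + b) - f (v - a)) - (f (v + b) - f v) := by
  have f1 : SqSummable fun v => f (v - a) := hf.comp_sub a
  have f2 : SqSummable fun v => f (v + b) := hf.comp_add b
  have f3 : SqSummable fun v => f (v - a + b) := by
    simpa only [sub_add_eq_add_sub] using f1.comp_add b
  exact (f3.sub f1).sub (f2.sub hf)

/-- Summation by parts for a mixed second difference: the adjoint of `∇_e ∇_f^*` is `∇_e^* ∇_f`. -/
lemma pair_mixed (hf : SqSummable f) (hg : SqSummable g) (a b : Fin d → ℤ) :
    pair f (fun v => (g (v + a - b) - g (v + a)) - (g (v - b) - g v)) =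
      pair (fun v => (f (v - a + b) - f (v - a)) - (f (v + b) - f v)) g := by
  have g1 : SqSummable fun v => g (v + a) := hg.comp_add a
  have g2 : SqSummable fun v => g (v - b) := hg.comp_sub b
  have g3 : SqSummable fun v => g (v + a - b) := by
    simpa only [add_sub_right_comm] using g2.comp_add a
  have f1 : SqSummable fun v => f (v - a) := hf.comp_sub a
  have f2 : SqSummable fun v => f (v + b) := hf.comp_add b
  have f3 : SqSummable fun v => f (v - a + b) := by
    simpa only [sub_add_eq_add_sub] using f1.comp_add b
  rw [pair_sub_right hf (g3.sub g1) (g2.sub hg), pair_sub_right hf g3 g1, pair_sub_right hf g2 hg,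
    pair_sub_left hg (f3.sub f1) (f2.sub hf), pair_sub_left hg f3 f1, pair_sub_left hg f2 hf,
    pair_add_shift, pair_sub_shift]
  congr 2
  have h1 := pair_add_shift f (fun v => g (v - b)) a
  rw [pair_sub_shift] at h1
  simp only [sub_add_eq_add_sub] at h1 ⊢
  exact h1

lemma negLap_eq_mixed (l : Fin d) (f : (Fin d → ℤ) → ℝ) :
    negLap l f = fun v => (f (v + Pi.single l 1 - Pi.single l 1) - f (v + Pi.single l 1)) -
      (f (v - Pi.single l 1) - f v) := by
  funext v
  simp only [negLap, add_sub_cancel_right]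
  ring

lemma pair_negLap (hf : SqSummable f) (hg : SqSummable g) (l : Fin d) :
    pair f (negLap l g) = pair (negLap l f) g := by
  rw [negLap_eq_mixed, pair_mixed hf hg]
  congr 1
  funext v
  simp only [negLap, sub_add_cancel]
  ring

lemma pair_negLap_self_nonneg (hf : SqSummable f) (l : Fin d) : 0 ≤ pair f (negLap l f) := by
  have hf' := hf.comp_add (Pi.single l 1)
  have hf'' := hf.comp_sub (Pi.single l 1)
  have h : pair f (negLap l f) =
      ∑' v, (f (v + Pi.single l 1) - f v) * (f (v + Pi.single l 1) - f v) := by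
    change _ = pair (fun v => f (v + Pi.single l 1) - f v) (fun v => f (v + Pi.single l 1) - f v)
    have h1 := pair_add_shift (fun v => f (v + Pi.single l 1)) f (Pi.single l 1)
    simp only [sub_add_cancel] at h1
    rw [negLap_eq_mixed]
    simp only [add_sub_cancel_right]
    rw [pair_sub_right hf (hf.sub hf') (hf''.sub hf), pair_sub_right hf hf hf',
      pair_sub_right hf hf'' hf, pair_sub_right (hf'.sub hf) hf' hf, pair_sub_left hf' hf' hf,
      pair_sub_left hf hf' hf, h1, pair_sub_shift]
  rw [h]
  exact tsum_nonneg fun v => mul_self_nonneg _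

end Pairing

/-! ### The massive approximation of the projected plaquette -/

section Approx

/-- The Green function centred at `v₀`. -/
def greenAt (ε : ℝ) (v₀ v : Fin d → ℤ) : ℝ := green d ε (v - v₀)

lemma sqSummable_greenAt {ε : ℝ} (hε : 0 < ε) (v₀ : Fin d → ℤ) : SqSummable (greenAt ε v₀) :=
  SqSummable.comp_sub (f := green d ε) (summable_sq_green hε) v₀

lemma negLap_greenAt_apply (l : Fin d) (ε : ℝ) (v₀ v : Fin d → ℤ) :
    negLap l (greenAt ε v₀) v = negLap l (green d ε) (v - v₀) := by
  simp only [negLap, greenAt, add_sub_right_comm, sub_right_comm]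

lemma sum_negLap_greenAt {ε : ℝ} (hε : 0 < ε) (v₀ v : Fin d → ℤ) :
    ∑ l, negLap l (greenAt ε v₀) v = (if v = v₀ then 1 else 0) - ε * greenAt ε v₀ v := by
  have := negLap_green hε (v - v₀)
  simp only [sub_eq_zero] at this
  simp only [negLap_greenAt_apply]
  rw [← this, greenAt]
  ring

lemma pair_sum_negLap_greenAt {ε : ℝ} (hε : 0 < ε) (v₀ : Fin d → ℤ) {f : (Fin d → ℤ) → ℝ}
    (hf : SqSummable f) :
    ∑ l, pair (negLap l f) (greenAt ε v₀) = f v₀ - ε * pair f (greenAt ε v₀) := by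
  have hg := sqSummable_greenAt hε v₀
  simp only [← pair_negLap hf hg, pair_comm f]
  rw [← pair_finset_sum_left _ (fun l => hg.negLap l) hf]
  simp only [sum_negLap_greenAt hε]
  unfold pair
  rw [← tsum_mul_left]
  have h1 : ∀ v, ((if v = v₀ then 1 else 0) - ε * greenAt ε v₀ v) * f v =
      (if v = v₀ then f v₀ else 0) - ε * (greenAt ε v₀ v * f v) := by
    intro v
    split_ifs with h
    · rw [h]; ring
    · ring
  simp only [h1]
  rw [Summable.tsum_sub _ ((hg.summable_mul hf).mul_left ε), tsum_ite_eq]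
  exact (hasSum_ite_eq v₀ (f v₀)).summable

/-- The massive Green function vanishes in the scaling `ε g_ε → 0`: for `ε = t⁴`, pairing with a unit
vector of `ℓ²` gives at most `t`. -/
lemma abs_eps_pair_greenAt_le (i : Fin d) {t : ℝ} (ht : 0 < t) (v₀ : Fin d → ℤ)
    {f : (Fin d → ℤ) → ℝ} (hf : SqSummable f) (hf1 : ∑' v, f v ^ 2 ≤ 1) :
    |t ^ 4 * pair f (greenAt (t ^ 4) v₀)| ≤ t := by
  have hε : 0 < t ^ 4 := by positivity
  have hg := sqSummable_greenAt hε v₀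
  have hg2 : t ^ 4 * ∑' v, greenAt (t ^ 4) v₀ v ^ 2 ≤ 1 / (2 * t ^ 2) := by
    have h1 := pair_sum_negLap_greenAt hε v₀ hg
    have h2 : 0 ≤ ∑ l, pair (negLap l (greenAt (t ^ 4) v₀)) (greenAt (t ^ 4) v₀) :=
      Finset.sum_nonneg fun l _ => by
        rw [pair_comm]
        exact pair_negLap_self_nonneg hg l
    have h3 := green_zero_le i hε
    have h4 : √(t ^ 4) = t ^ 2 := by
      rw [show t ^ 4 = (t ^ 2) ^ 2 by ring, Real.sqrt_sq (by positivity)]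
    rw [h4] at h3
    have h5 : greenAt (t ^ 4) v₀ v₀ = green d (t ^ 4) 0 := by rw [greenAt, sub_self]
    have h6 : pair (greenAt (t ^ 4) v₀) (greenAt (t ^ 4) v₀) =
        ∑' v, greenAt (t ^ 4) v₀ v ^ 2 := by
      unfold pair
      simp only [sq]
    rw [h5, h6] at h1
    linarith
  -- Weighted arithmetic-geometric mean inequality, with weights `t` and `t⁻¹`.
  have hpt : ∀ v, ‖t ^ 4 * (f v * greenAt (t ^ 4) v₀ v)‖ ≤
      t / 2 * f v ^ 2 + t ^ 7 / 2 * greenAt (t ^ 4) v₀ v ^ 2 := by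
    intro v
    have h0 : t / 2 * f v ^ 2 + t ^ 7 / 2 * greenAt (t ^ 4) v₀ v ^ 2 =
        t / 2 * (f v ^ 2 + (t ^ 3 * greenAt (t ^ 4) v₀ v) ^ 2) := by ring
    have h1 : t ^ 4 * (f v * greenAt (t ^ 4) v₀ v) =
        t / 2 * (2 * f v * (t ^ 3 * greenAt (t ^ 4) v₀ v)) := by ring
    rw [h0, h1, norm_mul, Real.norm_of_nonneg (by positivity)]
    gcongr
    rw [Real.norm_eq_abs, abs_le]
    constructor
    · nlinarith [sq_nonneg (f v + t ^ 3 * greenAt (t ^ 4) v₀ v)]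
    · nlinarith [sq_nonneg (f v - t ^ 3 * greenAt (t ^ 4) v₀ v)]
  have hsum := (Summable.mul_left (t / 2) hf).add (Summable.mul_left (t ^ 7 / 2) hg)
  have h1 := tsum_of_norm_bounded hsum.hasSum hpt
  rw [tsum_mul_left, Summable.tsum_add (Summable.mul_left _ hf) (Summable.mul_left _ hg),
    tsum_mul_left, tsum_mul_left, Real.norm_eq_abs] at h1
  refine h1.trans ?_
  have h2 : t ^ 7 / 2 * ∑' v, greenAt (t ^ 4) v₀ v ^ 2 ≤ t / 4 := by
    calc t ^ 7 / 2 * ∑' v, greenAt (t ^ 4) v₀ v ^ 2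
        = t ^ 3 / 2 * (t ^ 4 * ∑' v, greenAt (t ^ 4) v₀ v ^ 2) := by ring
      _ ≤ t ^ 3 / 2 * (1 / (2 * t ^ 2)) := by gcongr
      _ = t / 4 := by field_simp; norm_num
  nlinarith

/-- Plaquettes as pairs of a pair of directions and a lowest vertex. -/
def plaqEquiv (d : ℕ) : {q : Fin d × Fin d // q.1 < q.2} × (Fin d → ℤ) ≃ Plaquette d :=
  Equiv.ofBijective (fun q => plaq q.2 q.1.1.1 q.1.1.2 q.1.2.ne) (by
    constructor
    · rintro ⟨⟨⟨a, b⟩, h⟩, v⟩ ⟨⟨⟨a', b'⟩, h'⟩, v'⟩ hq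
      have h1 : v = v' := congrArg (fun p : Plaquette d => p.1.base) hq
      have h2 : ({a, b} : Finset (Fin d)) = {a', b'} :=
        congrArg (fun p : Plaquette d => p.1.dirs) hq
      have ha : a = a' ∨ a = b' := by
        have : a ∈ ({a', b'} : Finset (Fin d)) := h2 ▸ (by simp)
        simpa using this
      have hb : b = a' ∨ b = b' := by
        have : b ∈ ({a', b'} : Finset (Fin d)) := h2 ▸ (by simp)
        simpa using this
      simp only at h h'
      have : a = a' ∧ b = b' := by
        rcases ha with rfl | rfl <;> rcases hb with rfl | rfl
        · exact absurd h (lt_irrefl _)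
        · exact ⟨rfl, rfl⟩
        · exact absurd (h.trans h') (lt_irrefl _)
        · exact absurd h (lt_irrefl _)
      obtain ⟨rfl, rfl⟩ := this
      rw [h1]
    · intro p
      obtain ⟨a, b, h, hp⟩ := exists_eq_plaq p
      exact ⟨⟨⟨⟨a, b⟩, h⟩, p.1.base⟩, hp.symm⟩)

lemma sqSummable_comp {c : Cochain (lattice d) 2 ℝ} (hc : Summable fun p => c p ^ 2)
    (a b : Fin d) : SqSummable (comp c a b) := by
  have key : ∀ a b : Fin d, a < b → SqSummable (comp c a b) := by
    intro a b h
    have := hc.comp_injective (i := fun v => plaq v a b h.ne)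
      (fun v v' hv => congrArg (fun p : Plaquette d => p.1.base) hv)
    exact this.congr fun v => by rw [comp_of_lt c h]; rfl
  rcases lt_trichotomy a b with h | rfl | h
  · exact key a b h
  · exact summable_zero.congr fun v => by rw [comp_self]; simp
  · exact (key b a h).congr fun v => by rw [comp_swap c a b]; ring

lemma tsum_sq_comp_le {c : Cochain (lattice d) 2 ℝ} (hc : Summable fun p => c p ^ 2)
    {a b : Fin d} (h : a < b) : ∑' v, comp c a b v ^ 2 ≤ ∑' p, c p ^ 2 := by
  simp only [comp_of_lt c h]
  exact tsum_comp_le_tsum_of_inj hc (fun p => sq_nonneg _)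
      (i := fun v => plaq v a b h.ne) (fun v v' hv => congrArg (fun p : Plaquette d => p.1.base) hv)

lemma summable_plaquette {f : Plaquette d → ℝ} (h0 : ∀ p, 0 ≤ f p)
    (hf : ∀ a b (h : a < b), Summable fun v => f (plaq v a b h.ne)) : Summable f := by
  rw [← (plaqEquiv d).summable_iff]
  exact (summable_prod_of_nonneg (f := fun q => f (plaqEquiv d q)) fun _ => h0 _).2
    ⟨fun q => hf _ _ q.2, (hasSum_fintype _).summable⟩

lemma sum_lt_add_swap (F : Fin d → Fin d → ℝ) (h0 : ∀ a, F a a = 0) :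
    ∑ q : {q : Fin d × Fin d // q.1 < q.2}, (F q.1.1 q.1.2 + F q.1.2 q.1.1) = ∑ a, ∑ b, F a b := by
  have h1 : ∑ q : {q : Fin d × Fin d // q.1 < q.2}, (F q.1.1 q.1.2 + F q.1.2 q.1.1) =
      ∑ q : Fin d × Fin d, if q.1 < q.2 then F q.1 q.2 + F q.2 q.1 else 0 := by
    rw [← Finset.sum_filter, Finset.sum_subtype (p := fun q : Fin d × Fin d => q.1 < q.2)]
    simp
  rw [h1, Fintype.sum_prod_type]
  have h2 : ∀ a b, F a b = (if a < b then F a b else 0) + (if b < a then F a b else 0) := by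
    intro a b
    rcases lt_trichotomy a b with h | rfl | h
    · simp [h, h.not_gt]
    · simp [h0]
    · simp [h, h.not_gt]
  have h3 : ∑ a, ∑ b, F a b = ∑ a, ∑ b, (if a < b then F a b else 0) +
      ∑ a, ∑ b, (if b < a then F a b else 0) := by
    rw [← Finset.sum_add_distrib]
    refine Finset.sum_congr rfl fun a _ => ?_
    rw [← Finset.sum_add_distrib]
    exact Finset.sum_congr rfl fun b _ => h2 a b
  rw [h3, Finset.sum_comm (f := fun a b => if b < a then F a b else 0), ← Finset.sum_add_distrib]
  refine Finset.sum_congr rfl fun a _ => ?_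
  rw [← Finset.sum_add_distrib]
  refine Finset.sum_congr rfl fun b _ => ?_
  split_ifs <;> simp

lemma tsum_mul_eq_sum_tsum {c y : Plaquette d → ℝ} (hc : Summable fun p => c p ^ 2)
    (hy : Summable fun p => y p ^ 2) :
    ∑' p, c p * y p = ∑ q : {q : Fin d × Fin d // q.1 < q.2},
      ∑' v, c (plaq v q.1.1 q.1.2 q.2.ne) * y (plaq v q.1.1 q.1.2 q.2.ne) := by
  have hcy : Summable fun p => c p * y p := by
    refine Summable.of_norm_bounded (hc.add hy) fun p => ?_
    rw [Real.norm_eq_abs, abs_mul, ← sq_abs (c p), ← sq_abs (y p)]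
    nlinarith [sq_nonneg (|c p| - |y p|), abs_nonneg (c p), abs_nonneg (y p)]
  have h1 : Summable fun q => c (plaqEquiv d q) * y (plaqEquiv d q) :=
    (plaqEquiv d).summable_iff.2 hcy
  rw [← (plaqEquiv d).tsum_eq, h1.tsum_prod, tsum_fintype]
  rfl

/-- The pairing of 2-cochains with an exact one, in components. -/
lemma tsum_mul_coboundary {c : Cochain (lattice d) 2 ℝ} (hc : Summable fun p => c p ^ 2)
    {α : Cochain (lattice d) 1 ℝ} (hα : ∀ b, SqSummable fun v => α (edge v b)) :
    ∑' p, c p * coboundary ℝ (lattice d) 1 ℝ α p =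
      ∑ a, ∑ b, pair (comp c a b) fun v => α (edge (v + Pi.single a 1) b) - α (edge v b) := by
  have hd : ∀ a b, SqSummable fun v => α (edge (v + Pi.single a 1) b) - α (edge v b) := fun a b =>
    ((hα b).comp_add (Pi.single a 1)).sub (hα b)
  have hcab := sqSummable_comp hc
  have hy : Summable fun p => coboundary ℝ (lattice d) 1 ℝ α p ^ 2 := by
    refine summable_plaquette (fun _ => sq_nonneg _) fun a b h => ?_
    exact ((hd a b).sub (hd b a)).congr fun v => by rw [coboundary_plaq ℝ α v h]
  refine (tsum_mul_eq_sum_tsum hc hy).trans ?_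
  rw [← sum_lt_add_swap _ fun a => by simp [pair, comp_self]]
  refine Finset.sum_congr rfl fun q _ => ?_
  rw [pair, pair, ← ((hcab _ _).summable_mul (hd _ _)).tsum_add ((hcab _ _).summable_mul (hd _ _))]
  refine tsum_congr fun v => ?_
  rw [coboundary_plaq ℝ α v q.2, comp_swap c q.1.1 q.1.2, comp_of_lt c q.2]
  ring

/-- The 1-cochain `d^* u`, for the 2-cochain `u` given by the massive Green function on the
plaquettes parallel to a given one. -/
def approxPotential (ε : ℝ) (v₀ : Fin d → ℤ) (i j : Fin d) : Cochain (lattice d) 1 ℝ := fun σ =>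
  (if edgeDir σ = j then
    greenAt ε v₀ (σ.1.base - Pi.single i 1) - greenAt ε v₀ σ.1.base else 0) -
  (if edgeDir σ = i then
    greenAt ε v₀ (σ.1.base - Pi.single j 1) - greenAt ε v₀ σ.1.base else 0)

lemma approxPotential_edge (ε : ℝ) (v₀ : Fin d → ℤ) (i j : Fin d) (v : Fin d → ℤ) (b : Fin d) :
    approxPotential ε v₀ i j (edge v b) =
      (if b = j then greenAt ε v₀ (v - Pi.single i 1) - greenAt ε v₀ v else 0) -
      (if b = i then greenAt ε v₀ (v - Pi.single j 1) - greenAt ε v₀ v else 0) := by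
  unfold approxPotential
  rw [edgeDir_edge]
  rfl

lemma sqSummable_approxPotential {ε : ℝ} (hε : 0 < ε) (v₀ : Fin d → ℤ) (i j b : Fin d) :
    SqSummable fun v => approxPotential ε v₀ i j (edge v b) := by
  have hg := sqSummable_greenAt hε v₀
  have h0 : SqSummable fun _ : Fin d → ℤ => (0 : ℝ) :=
    summable_zero.congr fun v => by simp
  simp only [approxPotential_edge]
  refine SqSummable.sub ?_ ?_
  · split_ifs
    exacts [(hg.comp_sub _).sub hg, h0]
  · split_ifs
    exacts [(hg.comp_sub _).sub hg, h0]

/-- On closed square-summable cochains, pairing with `d d^* (-Δ + ε)⁻¹ δ_p` is evaluation at `p` up to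
an error that vanishes with `ε`: since `d d^* = -Δ - d^* d`, and `d^* d` drops out. -/
lemma tsum_mul_coboundary_approxPotential {ε : ℝ} (hε : 0 < ε) (v₀ : Fin d → ℤ) {i j : Fin d}
    (h : i < j) {c : Cochain (lattice d) 2 ℝ} (hc : Summable fun p => c p ^ 2)
    (hclosed : IsClosedCochain c) :
    ∑' p, c p * coboundary ℝ (lattice d) 1 ℝ (approxPotential ε v₀ i j) p =
      c (plaq v₀ i j h.ne) - ε * pair (comp c i j) (greenAt ε v₀) := by
  have hcab := sqSummable_comp hc
  have hg := sqSummable_greenAt hε v₀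
  have hcij : c (plaq v₀ i j h.ne) = comp c i j v₀ := (comp_of_lt c h v₀).symm
  rw [tsum_mul_coboundary hc (sqSummable_approxPotential hε v₀ i j), hcij,
    ← pair_sum_negLap_greenAt hε v₀ (hcab i j)]
  refine Finset.sum_congr rfl fun a _ => ?_
  have h0 : ∀ f : (Fin d → ℤ) → ℝ, pair f (fun _ => 0) = 0 := fun f => by simp [pair]
  have h2 : ∀ b, pair (comp c a b) (fun v => approxPotential ε v₀ i j (edge (v + Pi.single a 1) b) -
      approxPotential ε v₀ i j (edge v b)) =
      (if b = j then pair (comp c a j) (fun v =>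
        (greenAt ε v₀ (v + Pi.single a 1 - Pi.single i 1) - greenAt ε v₀ (v + Pi.single a 1)) -
          (greenAt ε v₀ (v - Pi.single i 1) - greenAt ε v₀ v)) else 0) -
      (if b = i then pair (comp c a i) (fun v =>
        (greenAt ε v₀ (v + Pi.single a 1 - Pi.single j 1) - greenAt ε v₀ (v + Pi.single a 1)) -
          (greenAt ε v₀ (v - Pi.single j 1) - greenAt ε v₀ v)) else 0) := by
    intro b
    simp only [approxPotential_edge]
    by_cases hj : b = j
    · subst hj
      simp only [if_true, if_neg h.ne', sub_zero]
    · by_cases hi : b = i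
      · subst hi
        simp only [if_true, if_neg hj, zero_sub]
        rw [← pair_neg_right]
        congr 1
        funext v
        ring
      · simp only [if_neg hi, if_neg hj, sub_zero, h0]
  simp only [h2]
  rw [Finset.sum_sub_distrib, Finset.sum_ite_eq' Finset.univ j, Finset.sum_ite_eq' Finset.univ i,
    if_pos (Finset.mem_univ _), if_pos (Finset.mem_univ _), pair_mixed (hcab a j) hg,
    pair_mixed (hcab a i) hg, ← pair_sub_left hg (sqSummable_mixed (hcab a j) _ _)
      (sqSummable_mixed (hcab a i) _ _)]
  congr 1
  funext v
  have e1 := hclosed a i j v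
  have e2 := hclosed a i j (v - Pi.single a 1)
  simp only [sub_add_cancel] at e2
  simp only [comp_swap c a j] at e1 e2
  simp only [negLap]
  linarith

variable [NeZero d]

/-- The exact 2-cochain `d d^* (-Δ + ε)⁻¹ δ_p` for `p` the plaquette at `v₀` in directions `i, j`. It
approximates the projection of `δ_p` as `ε → 0`. -/
def approxProj {ε : ℝ} (hε : 0 < ε) (v₀ : Fin d → ℤ) (i j : Fin d) : exactL2 d :=
  ⟨⟨coboundary ℝ (lattice d) 1 ℝ (approxPotential ε v₀ i j), by
    refine (memℓp_two_iff _).2 ?_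
    have hα := sqSummable_approxPotential hε v₀ i j
    have hd : ∀ a b, SqSummable fun v => approxPotential ε v₀ i j (edge (v + Pi.single a 1) b) -
      approxPotential ε v₀ i j (edge v b) := fun a b =>
        ((hα b).comp_add (Pi.single a 1)).sub (hα b)
    refine summable_plaquette (fun _ => sq_nonneg _) fun a b h => ?_
    exact ((hd a b).sub (hd b a)).congr fun v => by rw [coboundary_plaq ℝ _ v h]⟩,
    coboundary_mem_limitExact ℝ _⟩

lemma approxProj_plaq {ε : ℝ} (hε : 0 < ε) (v₀ v : Fin d → ℤ) {i j : Fin d} (h : i < j) :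
    (approxProj hε v₀ i j).1 (plaq v i j h.ne) =
      negLap i (green d ε) (v - v₀) + negLap j (green d ε) (v - v₀) := by
  change coboundary ℝ (lattice d) 1 ℝ (approxPotential ε v₀ i j) (plaq v i j h.ne) = _
  rw [coboundary_plaq ℝ _ v h, ← negLap_greenAt_apply, ← negLap_greenAt_apply]
  simp only [approxPotential_edge, if_true, if_neg h.ne, if_neg h.ne', negLap,
    add_sub_cancel_right]
  ring

lemma inner_approxProj {ε : ℝ} (hε : 0 < ε) (v₀ : Fin d → ℤ) {i j : Fin d} (h : i < j)
    (x : exactL2 d) :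
    inner ℝ x (approxProj hε v₀ i j) =
      x.1 (plaq v₀ i j h.ne) - ε * pair (comp (A := ℝ) (⇑x.1) i j) (greenAt ε v₀) := by
  rw [← tsum_mul_coboundary_approxPotential hε v₀ h ((memℓp_two_iff _).1 x.1.2)
    (mem_limitExact_iff_isClosedCochain.1 x.2), Submodule.coe_inner, lp.inner_eq_tsum]
  refine tsum_congr fun p => ?_
  exact mul_comm _ _

end Approx

/-! ### Decay of the two-point function along a lattice direction -/

section Decay

/-- On a lattice axis the Green kernel of two parallel plaquettes is bounded below by a second
difference transverse to the axis: either directly, or, if the axis is parallel to the plaquettes,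
through the equation `(-Δ + ε) g_ε = 0` off the origin, whose remaining terms all have one sign. -/
lemma exists_le_abs_negLap_add_negLap (hd : 2 < d) : ∃ C : ℝ, 0 < C ∧ ∀ (n : ℕ), 1 ≤ n →
    ∀ ε : ℝ, 0 < ε → ε ≤ 1 / (16 * n ^ 2) → ∀ (k i j : Fin d), i ≠ j → ∀ m : ℤ, m.natAbs = n →
      C / n ^ d ≤ |negLap i (green d ε) (Pi.single k m) + negLap j (green d ε) (Pi.single k m)| := by
  obtain ⟨C, hC, h⟩ := exists_le_negLap_green (d := d) (by omega)
  refine ⟨C, hC, fun n hn ε hε hεn k i j hij m hm => ?_⟩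
  have hnonneg : ∀ l, l ≠ k → 0 ≤ negLap l (green d ε) (Pi.single k m) := fun l hl =>
    negLap_green_single_nonneg k hε hl m
  by_cases hk : i ≠ k ∧ j ≠ k
  · have h1 := h n hn ε hε hεn k i hk.1 m hm
    have h2 := hnonneg j hk.2
    exact le_trans (by linarith) (le_abs_self _)
  · have hk' : ∀ l, l ≠ i → l ≠ j → l ≠ k := by
      rintro l hi hj rfl
      exact hk ⟨hi.symm, hj.symm⟩
    have hm0 : (Pi.single k m : Fin d → ℤ) ≠ 0 := by
      rw [Ne, Pi.single_eq_zero_iff]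
      omega
    have hsum := negLap_green hε (Pi.single k m)
    rw [if_neg hm0, ← Finset.add_sum_erase _ _ (Finset.mem_univ i),
      ← Finset.add_sum_erase _ _ (Finset.mem_erase.2 ⟨hij.symm, Finset.mem_univ j⟩)] at hsum
    have hcard : 0 < ((Finset.univ.erase i).erase j).card := by
      rw [Finset.card_erase_of_mem (Finset.mem_erase.2 ⟨hij.symm, Finset.mem_univ j⟩),
        Finset.card_erase_of_mem (Finset.mem_univ i), Finset.card_univ, Fintype.card_fin]
      omega
    obtain ⟨l, hl⟩ := Finset.card_pos.1 hcard
    have hne : ∀ l ∈ (Finset.univ.erase i).erase j, l ≠ k := fun l hl =>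
      hk' l (Finset.ne_of_mem_erase (Finset.mem_of_mem_erase hl)) (Finset.ne_of_mem_erase hl)
    have h1 : negLap l (green d ε) (Pi.single k m) ≤
        ∑ l ∈ (Finset.univ.erase i).erase j, negLap l (green d ε) (Pi.single k m) :=
      Finset.single_le_sum (f := fun l => negLap l (green d ε) (Pi.single k m))
        (fun l hl => hnonneg l (hne l hl)) hl
    have h2 := h n hn ε hε hεn k l (hne l hl) m hm
    have h3 := mul_nonneg hε.le (green_single_nonneg k hε m)
    exact le_trans (by linarith) (neg_le_abs _)

lemma exists_eq_single {e : Fin d → ℤ} (he : IsLatticeDirection e) : ∃ k, ∀ n : ℕ, ∃ m : ℤ,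
    (n : ℤ) • e = Pi.single k m ∧ m.natAbs = n := by
  obtain ⟨k, rfl | rfl⟩ := he
  · exact ⟨k, fun n => ⟨n, by rw [← Pi.single_smul, smul_eq_mul, mul_one], by simp⟩⟩
  · exact ⟨k, fun n => ⟨-n, by rw [smul_neg, ← Pi.single_smul, smul_eq_mul, mul_one,
      Pi.single_neg], by simp⟩⟩

variable [NeZero d]

lemma projDelta_symm (p q : Plaquette d) : (projDelta q).1 p = (projDelta p).1 q := by
  rw [← inner_projDelta, ← inner_projDelta, real_inner_comm]

lemma abs_projDelta_le_one (p q : Plaquette d) : |(projDelta p).1 q| ≤ 1 :=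
  (lp.norm_apply_le_norm (by simp) (projDelta p).1 q).trans (norm_projDelta_le_one p)

lemma tsum_sq_projDelta_le_one (p : Plaquette d) : ∑' q, (projDelta p).1 q ^ 2 ≤ 1 := by
  have h1 := norm_projDelta_le_one p
  have h2 : ‖projDelta p‖ ^ 2 = ∑' q, (projDelta p).1 q ^ 2 := by
    rw [← real_inner_self_eq_norm_sq, Submodule.coe_inner, lp.inner_eq_tsum]
    exact tsum_congr fun q => (sq _).symm
  rw [← h2]
  exact pow_le_one₀ (norm_nonneg _) h1

/-- The kernel of the projection onto exact cochains at parallel plaquettes, as the massless limit of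
second differences of the Green function. -/
lemma abs_approxProj_sub_projDelta_le {t : ℝ} (ht : 0 < t) (v₀ v : Fin d → ℤ) {i j : Fin d}
    (h : i < j) :
    |negLap i (green d (t ^ 4)) (v - v₀) + negLap j (green d (t ^ 4)) (v - v₀) -
      (projDelta (plaq v₀ i j h.ne)).1 (plaq v i j h.ne)| ≤ t := by
  have h1 := inner_approxProj (pow_pos ht 4) v₀ h (projDelta (plaq v i j h.ne))
  rw [inner_projDelta, approxProj_plaq _ _ _ h, projDelta_symm] at h1
  have hs := (memℓp_two_iff _).1 (projDelta (plaq v i j h.ne)).1.2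
  rw [h1, sub_sub_cancel_left, abs_neg]
  exact abs_eps_pair_greenAt_le i ht v₀ (sqSummable_comp hs i j)
    ((tsum_sq_comp_le hs h).trans (tsum_sq_projDelta_le_one _))

lemma exists_le_abs_projDelta_shift (hd : 2 < d) : ∃ C : ℝ, 0 < C ∧
    ∀ (p : Plaquette d) (e : Fin d → ℤ), IsLatticeDirection e → ∀ n : ℕ, 1 ≤ n →
      C / n ^ d ≤ |(projDelta p).1 (Plaquette.shift ((n : ℤ) • e) p)| := by
  obtain ⟨C, hC, h⟩ := exists_le_abs_negLap_add_negLap hd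
  refine ⟨C, hC, fun p e he n hn => ?_⟩
  obtain ⟨k, hk⟩ := exists_eq_single he
  obtain ⟨m, hm, hmn⟩ := hk n
  rw [hm]
  obtain ⟨i, j, hij, hp⟩ := exists_eq_plaq p
  generalize p.1.base = v₀ at hp
  subst hp
  have hshift : Plaquette.shift (Pi.single k m) (plaq v₀ i j hij.ne) =
      plaq (v₀ + Pi.single k m) i j hij.ne := rfl
  rw [hshift]
  have hn' : (1 : ℝ) ≤ n := by exact_mod_cast hn
  have hδ : (0 : ℝ) < 1 / (16 * n ^ 2) := by positivity
  have hδ1 : 1 / (16 * (n : ℝ) ^ 2) ≤ 1 := by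
    rw [div_le_one (by positivity)]
    nlinarith
  refine le_of_forall_pos_le_add fun t ht => ?_
  -- A mass parameter `s⁴` below the threshold and an error `s ≤ t`.
  set s := min t (1 / (16 * (n : ℝ) ^ 2)) with hs
  have hs0 : 0 < s := lt_min ht hδ
  have hs1 : s ^ 4 ≤ 1 / (16 * n ^ 2) :=
    (pow_le_of_le_one hs0.le ((min_le_right _ _).trans hδ1) (by norm_num)).trans (min_le_right _ _)
  have h1 := h n hn (s ^ 4) (pow_pos hs0 4) hs1 k i j hij.ne m hmn
  have h2 := abs_approxProj_sub_projDelta_le hs0 v₀ (v₀ + Pi.single k m) hij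
  rw [add_sub_cancel_left] at h2
  have h3 := abs_sub_abs_le_abs_sub
    (negLap i (green d (s ^ 4)) (Pi.single k m) + negLap j (green d (s ^ 4)) (Pi.single k m))
    ((projDelta (plaq v₀ i j hij.ne)).1 (plaq (v₀ + Pi.single k m) i j hij.ne))
  have h4 : s ≤ t := min_le_left _ _
  linarith

lemma tendsto_projDelta_shift (p : Plaquette d) {e : Fin d → ℤ} (he : IsLatticeDirection e) :
    Tendsto (fun n : ℕ => (projDelta p).1 (Plaquette.shift ((n : ℤ) • e) p)) atTop (𝓝 0) := by
  have hinj : Function.Injective fun n : ℕ => Plaquette.shift ((n : ℤ) • e) p := by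
    intro n n' h
    have h1 : p.1.base + (n : ℤ) • e = p.1.base + (n' : ℤ) • e :=
      congrArg (fun q : Plaquette d => q.1.base) h
    obtain ⟨k, hk⟩ := exists_eq_single he
    obtain ⟨m, hm, rfl⟩ := hk n
    obtain ⟨m', hm', rfl⟩ := hk n'
    rw [hm, hm', add_right_inj] at h1
    rw [Pi.single_injective k h1]
  have h1 := (((memℓp_two_iff _).1 (projDelta p).1.2).comp_injective hinj).tendsto_atTop_zero
  have h2 := h1.sqrt
  simp only [Real.sqrt_zero, Function.comp_apply, Real.sqrt_sq_eq_abs] at h2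
  exact (tendsto_zero_iff_abs_tendsto_zero _).2 h2

theorem tendsto_norm_correlation {β : ℝ} (hβ : 0 < β) (p : Plaquette d) {e : Fin d → ℤ}
    (he : IsLatticeDirection e) :
    Tendsto (fun n : ℕ => ‖correlation β p (Plaquette.shift ((n : ℤ) • e) p)‖) atTop (𝓝 0) := by
  have hcont : Continuous fun x : ℝ => |Real.exp (-8 * Real.pi ^ 2 * β * x) - 1| := by fun_prop
  have h1 := (hcont.tendsto 0).comp (tendsto_projDelta_shift p he)
  simp only [mul_zero, Real.exp_zero, sub_self, abs_zero] at h1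
  refine squeeze_zero (fun n => norm_nonneg _) (fun n => ?_) h1
  rw [norm_correlation hβ.le]
  refine mul_le_of_le_one_left (abs_nonneg _) (Real.exp_le_one_iff.2 ?_)
  have : 0 ≤ 4 * Real.pi ^ 2 * β * (‖projDelta p‖ ^ 2 +
    ‖projDelta (Plaquette.shift ((n : ℤ) • e) p)‖ ^ 2) := by positivity
  linarith

lemma abs_mul_exp_neg_le (s : ℝ) : |s| * Real.exp (-|s|) ≤ |Real.exp s - 1| := by
  rcases le_total 0 s with h | h
  · rw [abs_of_nonneg h, abs_of_nonneg (by linarith [Real.add_one_le_exp s])]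
    calc s * Real.exp (-s) ≤ s * 1 := by
          gcongr
          exact Real.exp_le_one_iff.2 (by linarith)
      _ ≤ _ := by linarith [Real.add_one_le_exp s]
  · rw [abs_of_nonpos h, abs_of_nonpos (by linarith [Real.exp_le_one_iff.2 h]), neg_neg]
    have h1 := Real.add_one_le_exp (-s)
    have h2 : Real.exp (-s) * Real.exp s = 1 := by rw [← Real.exp_add]; simp
    nlinarith [Real.exp_pos s]

theorem exists_le_norm_correlation (hd : 2 < d) {β : ℝ} (hβ : 0 < β) (p : Plaquette d)
    {e : Fin d → ℤ} (he : IsLatticeDirection e) : ∃ C : ℝ, 0 < C ∧ ∀ n : ℕ, 1 ≤ n →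
      C / n ^ d ≤ ‖correlation β p (Plaquette.shift ((n : ℤ) • e) p)‖ := by
  obtain ⟨C, hC, h⟩ := exists_le_abs_projDelta_shift hd
  set b : ℝ := 8 * Real.pi ^ 2 * β with hb
  have hb0 : 0 < b := by positivity
  refine ⟨Real.exp (-b) * (b * Real.exp (-b)) * C, by positivity, fun n hn => ?_⟩
  rw [norm_correlation hβ.le]
  have h1 := h p e he n hn
  have h2 := abs_projDelta_le_one p (Plaquette.shift ((n : ℤ) • e) p)
  have h3 := norm_projDelta_le_one p
  have h4 := norm_projDelta_le_one (Plaquette.shift ((n : ℤ) • e) p)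
  generalize (projDelta p).1 (Plaquette.shift ((n : ℤ) • e) p) = g at *
  generalize projDelta p = x at *
  generalize projDelta (Plaquette.shift ((n : ℤ) • e) p) = y at *
  have h5 : -b ≤ -4 * Real.pi ^ 2 * β * (‖x‖ ^ 2 + ‖y‖ ^ 2) := by
    have hx := pow_le_one₀ (n := 2) (norm_nonneg x) h3
    have hy := pow_le_one₀ (n := 2) (norm_nonneg y) h4
    have h0 : 0 < 4 * Real.pi ^ 2 * β := by positivity
    rw [hb]
    nlinarith
  have h6 := abs_mul_exp_neg_le (-8 * Real.pi ^ 2 * β * g)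
  have h7 : |-8 * Real.pi ^ 2 * β * g| = b * |g| := by
    rw [show -8 * Real.pi ^ 2 * β * g = -(b * g) by rw [hb]; ring, abs_neg, abs_mul,
      abs_of_pos hb0]
  rw [h7] at h6
  have h8 : Real.exp (-b) ≤ Real.exp (-(b * |g|)) := Real.exp_le_exp.2 (by nlinarith)
  calc Real.exp (-b) * (b * Real.exp (-b)) * C / n ^ d
      = Real.exp (-b) * (b * (C / n ^ d) * Real.exp (-b)) := by ring
    _ ≤ Real.exp (-4 * Real.pi ^ 2 * β * (‖x‖ ^ 2 + ‖y‖ ^ 2)) *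
        (b * |g| * Real.exp (-(b * |g|))) := by gcongr
    _ ≤ _ := by gcongr

end Decay

/-- Decay no faster than a power excludes exponential decay. -/
lemma not_isBigO_exp_of_le_norm {E : Type*} [NormedAddCommGroup E] {f : ℕ → E} {C : ℝ} (hC : 0 < C)
    (d : ℕ) (h : ∀ᶠ n : ℕ in atTop, C / (n : ℝ) ^ d ≤ ‖f n‖) {m : ℝ} (hm : 0 < m) :
    ¬ f =O[atTop] fun n : ℕ => Real.exp (-m * n) := by
  intro hf
  obtain ⟨K, hK⟩ := hf.bound
  have h1 : Tendsto (fun n : ℕ => K * ((n : ℝ) ^ d * Real.exp (-m * n))) atTop (𝓝 (K * 0)) := by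
    refine Tendsto.const_mul K (Tendsto.comp (g := fun x : ℝ => x ^ d * Real.exp (-m * x)) ?_
      tendsto_natCast_atTop_atTop)
    simpa only [Real.rpow_natCast] using tendsto_rpow_mul_exp_neg_mul_atTop_nhds_zero d m hm
  rw [mul_zero] at h1
  obtain ⟨n, hn1, hn2, hn3, hn4⟩ :=
    (h.and (hK.and ((h1.eventually (gt_mem_nhds hC)).and (eventually_ge_atTop 1)))).exists
  have hn' : (0 : ℝ) < (n : ℝ) ^ d := by positivity
  rw [Real.norm_of_nonneg (Real.exp_pos _).le] at hn2
  have h2 := hn1.trans hn2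
  rw [div_le_iff₀ hn'] at h2
  linarith [mul_assoc K (Real.exp (-m * n)) ((n : ℝ) ^ d),
    mul_comm ((n : ℝ) ^ d) (Real.exp (-m * n))]

end LatticeGauge

end

open LatticeGauge in
theorem theorem4p6 (d : ℕ) [NeZero d] (hd : 2 < d) (β : ℝ) (hβ : 0 < β) :
    (∃! ν : MeasureTheory.Measure (ExactG d), IsHeatKernelMeasure charDifferential β ν) ∧
    (∀ a : Fin d → ℤ, (latticeMeasure d β).map (translateGaugeClass a) = latticeMeasure d β) ∧
    ∀ (p : Plaquette d) (e : Fin d → ℤ), IsLatticeDirection e →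
      Filter.Tendsto (fun n : ℕ => ‖correlation β p (p.shift ((n : ℤ) • e))‖)
        Filter.atTop (nhds 0) ∧
      (∃ C : ℝ, 0 < C ∧ ∀ᶠ n : ℕ in Filter.atTop,
        C / (n : ℝ) ^ d ≤ ‖correlation β p (p.shift ((n : ℤ) • e))‖) ∧
      ∀ m : ℝ, 0 < m →
        ¬ ((fun n : ℕ => correlation β p (p.shift ((n : ℤ) • e))) =O[Filter.atTop]
          fun n : ℕ => Real.exp (-m * n)) := by
  obtain ⟨ν, hν⟩ := exists_isHeatKernelMeasure (d := d) hβ.le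
  refine ⟨⟨ν, hν, fun ν' hν' => hν'.unique hν⟩, map_translateGaugeClass_latticeMeasure hβ.le,
    fun p e he => ?_⟩
  obtain ⟨C, hC, h⟩ := exists_le_norm_correlation hd hβ p he
  have h' : ∀ᶠ n : ℕ in atTop, C / (n : ℝ) ^ d ≤
      ‖correlation β p (Plaquette.shift ((n : ℤ) • e) p)‖ := eventually_atTop.2 ⟨1, h⟩
  exact ⟨tendsto_norm_correlation hβ p he, ⟨C, hC, h'⟩, fun m hm =>
    not_isBigO_exp_of_le_norm hC d h' hm⟩
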